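/- Let $r\ge 1$ be an integer. For an odd integer $m\ge 1$ and $t\in\mathbb{C}$ with $\Re(t)>0$ let $$J_m(w,t)=\int_0^\infty (x^2+t^2)^{-w}x^m\tanh(\pi x)\,dx\qquad \Bigl(\Re(w)>\tfrac{m+1}{2}\Bigr),$$ and for $n\ge 1$ and $z\in\mathbb{C}\setminus\{0,-1,-2,\dots\}$ let $$\zeta_n(w,z)=\sum_{m_1,\dots,m_n\ge 0}(m_1+\cdots+m_n+z)^{-w}\qquad (\Re(w)>n),$$ all powers being taken with the principal logarithm. Derivatives in $w$ at $w=0$ are those of the meromorphic continuation in $w$ to $\mathbb{C}$. Put $\log\Gamma_n(z):=\frac{\partial}{\partial w}\zeta_n(w,z)\big|_{w=0}$, let $\Gamma_n(z):=\exp(\log\Gamma_n(z))$ be the Barnes multiple gamma function, and for $\Re(s)>\frac12$ define the gamma factor $$\phi_r(s):=\prod_{\ell=0}^{r-1}\exp\Bigl(-\frac{\partial}{\partial w}J_{2\ell+1}\bigl(w,s-\tfrac12\bigr)\Big|_{w=0}\Bigr)^{2\binom{r-1}{\ell}(s-\frac12)^{2(r-1-\ell)}},$$ where $\exp(a)^b$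 means $\exp(ab)$. For $1\le j\le 2r$ let $$\alpha_{r,j}(t):=4\sum_{\ell=\lfloor (j+1)/2\rfloor}^{r}\binom{r-1}{\ell-1}(-1)^{\ell-1}c_{2\ell,j}\bigl(\tfrac12\bigr)t^{2r-2\ell},\qquad c_{p,j}(z):=\sum_{l=0}^{j-1}\binom{j-1}{l}(-1)^l(z-l-1)^{p-1}.$$ **Theorem.** For all integers $0\le\ell<r$ and $1\le j\le 2r$, the function $J_{2\ell+1}(w,s-\frac12)$ (for $\Re(s)>\frac12$) and the function $\zeta_j(w,s)$ (for $s\notin\{0,-1,-2,\dots\}$) have meromorphic continuations in $w$ to $\mathbb{C}$ which are holomorphic at $w=0$. The polynomials $\alpha_{r,j}$ are even, and for $\Re(s)>\frac12$ $$\phi_r(s)=e^{-\frac{(2r)!!}{r^2(2r-1)!!}(s-\frac12)^{2r}}\prod_{j=1}^{2r}\Gamma_j(s)^{\alpha_{r,j}(s-\frac12)},\qquad \Gamma_j(s)^{a}:=\exp(a\log\Gamma_j(s)).$$ Moreover: (i) If $r=1$, then $\phi_1$ continues to a meromorphic function on $\mathbb{C}$ which is holomorphic outside $\{0,-1,-2,\dots\}$,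 has a pole of order exactly $2(2k+1)$ at $s=-k$ for every integer $k\ge 0$, and is given by the above formula for all $s\notin\{0,-1,-2,\dots\}$ (the exponents $\alpha_{1,j}$ are then integers, so no branch matters). (ii) If $r\ge 2$, then $\phi_r$ continues to a holomorphic function on $R:=\mathbb{C}\setminus\bigl((-\infty,-1]\cup[0,-i\infty)\bigr)$, where $[0,-i\infty)=\{-iy: y\ge 0\}$. For $1\le j\le 2r$ there are holomorphic functions $L_j$ on $R$ with $e^{L_j}=\Gamma_j$ on $R$ and $L_j=\log\Gamma_j$ on $\Re(s)>0$, and the above formula holds on all of $R$ with $\Gamma_j(s)^{a}:=\exp(aL_j(s))$. -/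

import Mathlib

open scoped Topology

/-- `d` is the derivative at `w₀` of the meromorphic continuation to `ℂ` of the function `f`
given on the half plane `Re w > c`; the continuation is required to be holomorphic at `w₀`. -/
def HasContinuedDerivAt (f : ℂ → ℂ) (c : ℝ) (w₀ d : ℂ) : Prop :=
  ∃ F : ℂ → ℂ, Meromorphic F ∧ (∀ w : ℂ, c < w.re → F w = f w) ∧
    AnalyticAt ℂ F w₀ ∧ deriv F w₀ = d

/-- The derivative of the meromorphic continuation does not depend on the continuation. -/
theorem HasContinuedDerivAt.unique {f : ℂ → ℂ} {c : ℝ} {w₀ d₁ d₂ : ℂ}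
    (h₁ : HasContinuedDerivAt f c w₀ d₁) (h₂ : HasContinuedDerivAt f c w₀ d₂) : d₁ = d₂ := by
  obtain ⟨F, hF, hFf, hFa, rfl⟩ := h₁
  obtain ⟨G, hG, hGf, hGa, rfl⟩ := h₂
  have hm : MeromorphicOn (F - G) Set.univ := fun x _ => (hF x).sub (hG x)
  have hopen : IsOpen {w : ℂ | c < w.re} := isOpen_lt continuous_const Complex.continuous_re
  have hx : ((c + 1 : ℝ) : ℂ) ∈ {w : ℂ | c < w.re} := by simp
  have htop : meromorphicOrderAt (F - G) ((c + 1 : ℝ) : ℂ) = ⊤ := by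
    rw [meromorphicOrderAt_eq_top_iff]
    refine Filter.Eventually.filter_mono nhdsWithin_le_nhds ?_
    filter_upwards [hopen.mem_nhds hx] with w hw
    simp [hFf w hw, hGf w hw]
  have htop' : meromorphicOrderAt (F - G) w₀ = ⊤ := by
    by_contra hne
    exact hm.meromorphicOrderAt_ne_top_of_isPreconnected isPreconnected_univ
      (Set.mem_univ w₀) (Set.mem_univ _) hne htop
  rw [meromorphicOrderAt_eq_top_iff] at htop'
  have hev : ∀ᶠ w in 𝓝 w₀, (F - G) w = 0 :=
    (hFa.sub hGa).frequently_zero_iff_eventually_zero.1 htop'.frequently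
  refine Filter.EventuallyEq.deriv_eq ?_
  filter_upwards [hev] with w hw
  exact sub_eq_zero.1 hw

open Classical in
/-- The derivative at `w₀` of the meromorphic continuation of `f` from `Re w > c`
(and `0` if there is no continuation that is holomorphic at `w₀`). -/
noncomputable def continuedDeriv (f : ℂ → ℂ) (c : ℝ) (w₀ : ℂ) : ℂ :=
  if h : ∃ d, HasContinuedDerivAt f c w₀ d then h.choose else 0

theorem HasContinuedDerivAt.continuedDeriv_eq {f : ℂ → ℂ} {c : ℝ} {w₀ d : ℂ}
    (h : HasContinuedDerivAt f c w₀ d) : continuedDeriv f c w₀ = d := by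
  have h' : ∃ d, HasContinuedDerivAt f c w₀ d := ⟨d, h⟩
  rw [continuedDeriv, dif_pos h']
  exact h'.choose_spec.unique h

/-- The Barnes multiple zeta series
`ζ_n(w, z) = ∑_{m₁, …, m_n ≥ 0} (m₁ + ⋯ + m_n + z)^{-w}` (used for `Re w > n`). -/
noncomputable def barnesZetaSeries (n : ℕ) (w z : ℂ) : ℂ :=
  ∑' m : Fin n → ℕ, ((∑ i, (m i : ℂ)) + z) ^ (-w)

/-- `log Γ_n(z) := ∂/∂w ζ_n(w, z)` at `w = 0`. -/
noncomputable def logBarnesGamma (n : ℕ) (z : ℂ) : ℂ :=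
  continuedDeriv (fun w => barnesZetaSeries n w z) n 0

/-- The Barnes multiple gamma function `Γ_n(z) = exp (∂/∂w ζ_n(w, z) |_{w = 0})`. -/
noncomputable def barnesGamma (n : ℕ) (z : ℂ) : ℂ :=
  Complex.exp (logBarnesGamma n z)

/-- The moment integral `J_m(w, t) = ∫_0^∞ (x² + t²)^{-w} x^m tanh(π x) dx`
(used for `Re w > (m + 1) / 2` and `Re t > 0`). -/
noncomputable def momentIntegral (m : ℕ) (w t : ℂ) : ℂ :=
  ∫ x in Set.Ioi (0 : ℝ),
    ((x : ℂ) ^ 2 + t ^ 2) ^ (-w) * (x : ℂ) ^ m * (Real.tanh (Real.pi * x) : ℂ)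

/-- `∂/∂w J_{2ℓ+1}(w, t)` at `w = 0`; here `(m + 1) / 2 = ℓ + 1` for `m = 2ℓ + 1`. -/
noncomputable def momentDeriv (ℓ : ℕ) (t : ℂ) : ℂ :=
  continuedDeriv (fun w => momentIntegral (2 * ℓ + 1) w t) ((ℓ : ℝ) + 1) 0

/-- The gamma factor
`φ_r(s) = ∏_{ℓ=0}^{r-1} exp(-∂/∂w J_{2ℓ+1}(w, t) |_{w=0})^{2 binom(r-1, ℓ) t^{2(r-1-ℓ)}}`
with `t = s - 1/2`, for `Re s > 1/2`. -/
noncomputable def gammaFactor (r : ℕ) (s : ℂ) : ℂ :=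
  ∏ ℓ ∈ Finset.range r,
    Complex.exp ((2 * ((r - 1).choose ℓ : ℂ) * (s - 1 / 2) ^ (2 * (r - 1 - ℓ))) *
      (-momentDeriv ℓ (s - 1 / 2)))

/-- `c_{r,j}(z) = ∑_{l=0}^{j-1} binom(j-1, l) (-1)^l (z - l - 1)^{r-1}`. -/
noncomputable def cCoeff (r j : ℕ) (z : ℂ) : ℂ :=
  ∑ l ∈ Finset.range j, ((j - 1).choose l : ℂ) * (-1) ^ l * (z - l - 1) ^ (r - 1)

/-- `α_{r,j}(t) = 4 ∑_{ℓ=⌊(j+1)/2⌋}^{r} binom(r-1, ℓ-1) (-1)^{ℓ-1} c_{2ℓ,j}(1/2) t^{2r-2ℓ}`. -/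
noncomputable def alphaPoly (r j : ℕ) : Polynomial ℂ :=
  4 * ∑ ℓ ∈ Finset.Icc ((j + 1) / 2) r,
    Polynomial.C (((r - 1).choose (ℓ - 1) : ℂ) * (-1) ^ (ℓ - 1) * cCoeff (2 * ℓ) j (1 / 2)) *
      Polynomial.X ^ (2 * r - 2 * ℓ)

/-- The elementary factor `exp(-((2r)!! / (r² (2r-1)!!)) (s - 1/2)^{2r})`. -/
noncomputable def expFactor (r : ℕ) (s : ℂ) : ℂ :=
  Complex.exp (-(((2 * r).doubleFactorial : ℂ) / ((r : ℂ) ^ 2 * ((2 * r - 1).doubleFactorial : ℂ)))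
    * (s - 1 / 2) ^ (2 * r))

/-- The region `ℂ ∖ ((-∞, -1] ∪ [0, -i∞))`. -/
def slitRegion : Set ℂ :=
  {s : ℂ | ¬ (s.im = 0 ∧ s.re ≤ -1) ∧ ¬ (s.re = 0 ∧ s.im ≤ 0)}

/-! Both sides come from the single weight 1/(e^{2πy}+1). Put t = s - 1/2. Since tanh(πx) = 1 -
2/(e^{2πx}+1), J_1(v,t) is an elementary term minus an integral against this weight that is entire
in v. Expanding x^{2ℓ} = ((x²+t²) - t²)^ℓ writes J_{2ℓ+1}(w,t) as a combination of the J_1(w-k,t),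
and the binomial exponents in φ_r undo this expansion: log φ_r collapses to -2 ∂_v J_1(v,t) at v =
-(r-1) (`sum_choose_mul_momentDeriv`).

On the Barnes side, the number of m with m_1+⋯+m_j = N is a polynomial P_j in N+s, so ζ_j(w,s) is a
combination of shifted Hurwitz series ∑(N+1/2+t)^{k-w}. Hermite's formula with half shift
(`hasSum_hurwitzCont`) continues these as t^{1-w}/(w-1) minus i times an integral of (t+iy)^{-w} -
(t-iy)^{-w} against the same weight. Hence log Γ_j(s) is a linear functional of P_j, sending X^k to
the derivative at w = -k.

The two sides meet in the identity ∑_j α_{r,j}(t) P_j = 4(X-t)(X(2t-X))^{r-1}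
(`sum_alphaPoly_smul_barnesPoly`), a Newton expansion followed by the binomial theorem. At X = t ±
ix the right side is ±4ix(x²+t²)^{r-1}, so the Hermite integral of this polynomial times log becomes
exactly the integral in the derivative of J_1 (`coeffSum_hurwitzContDeriv_gammaPoly`). Comparing
elementary terms leaves a multiple of ∫_0^t (x(2t-x))^{r-1} dx, a Wallis integral; this is the
exponential factor.

For the continuation, splitting off the layers N < M gives log Γ_n(z) = -∑_{N<M} binom(N+n-1,n-1)
log(N+z) plus a function holomorphic on Re z > 1/2 - M. For r = 1 the exponents are -2 and 4, so N+s
occurs to the power 2 - 4(N+1) = -2(2N+1). For r ≥ 2 the exponents are not constant and logarithms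
are needed; turning the cut of log s onto the negative imaginary axis gives branches on the slit
region. -/

/-! ### Sine transforms of 1/(e^{2πy} ∓ 1) -/

theorem integral_sin_mul_exp_neg (x : ℝ) {a : ℝ} (ha : 0 < a) :
    ∫ y in Set.Ioi (0 : ℝ), Real.sin (x * y) * Real.exp (-(a * y)) = x / (x ^ 2 + a ^ 2) := by
  set c : ℂ := -a + x * Complex.I with hc
  have hre : c.re < 0 := by simp [hc, ha]
  have h1 := integral_exp_mul_complex_Ioi hre 0
  have hint := integrableOn_exp_mul_complex_Ioi hre 0
  have h2 := integral_im hint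
  have h3 : ∀ y : ℝ, RCLike.im (Complex.exp (c * y)) = Real.sin (x * y) * Real.exp (-(a * y)) := by
    intro y
    simp [hc, Complex.exp_im, mul_comm]
  simp only [h3] at h2
  rw [h2, h1]
  simp [hc, Complex.div_im, Complex.normSq_apply]
  have : a * a + x * x ≠ 0 := by nlinarith [mul_pos ha ha, mul_self_nonneg x]
  have : x ^ 2 + a ^ 2 ≠ 0 := by nlinarith [mul_pos ha ha, mul_self_nonneg x]
  field_simp
  ring

theorem integrableOn_mul_exp_neg {b : ℝ} (hb : 0 < b) :
    MeasureTheory.IntegrableOn (fun y : ℝ => y * Real.exp (-(b * y))) (Set.Ioi 0) ∧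
      ∫ y in Set.Ioi (0 : ℝ), y * Real.exp (-(b * y)) = 1 / b ^ 2 := by
  have h := Real.integral_rpow_mul_exp_neg_mul_Ioi (a := 2) (by norm_num) hb
  have e : ∀ y : ℝ, y ^ ((2 : ℝ) - 1) = y := fun y => by norm_num
  simp only [e] at h
  have hv : (1 / b) ^ (2 : ℝ) * Real.Gamma 2 = 1 / b ^ 2 := by
    rw [Real.Gamma_two]; norm_num
  rw [hv] at h
  refine ⟨?_, h⟩
  -- The integral of a non-integrable function is 0 by convention, while the value found is
  -- positive.
  by_contra hn
  rw [MeasureTheory.integral_undef hn] at h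
  have : (0 : ℝ) < 1 / b ^ 2 := by positivity
  linarith

theorem hasSum_div_sq_add_sq {x : ℝ} (hx : 0 < x) :
    HasSum (fun n : ℕ => x / (x ^ 2 + (2 * Real.pi * (n + 1)) ^ 2))
      (∫ y in Set.Ioi (0 : ℝ), Real.sin (x * y) / (Real.exp (2 * Real.pi * y) - 1)) := by
  have hpos : ∀ n : ℕ, 0 < 2 * Real.pi * (n + 1 : ℝ) := fun n => by positivity
  -- The bound |sin(xy)| ≤ xy makes the L¹ norms O(1/n²); |sin| ≤ 1 would only give the divergent
  -- 1/n.
  have hb : ∀ n : ℕ, ∀ y ∈ Set.Ioi (0 : ℝ),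
      ‖Real.sin (x * y) * Real.exp (-(2 * Real.pi * (n + 1) * y))‖
        ≤ x * (y * Real.exp (-(2 * Real.pi * (n + 1) * y))) := by
    intro n y hy
    have hy : 0 < y := hy
    rw [norm_mul, Real.norm_of_nonneg (Real.exp_pos _).le, ← mul_assoc]
    gcongr
    have := Real.abs_sin_lt_abs (mul_pos hx hy).ne'
    rw [abs_of_pos (mul_pos hx hy)] at this
    exact this.le
  have hint : ∀ n : ℕ, MeasureTheory.IntegrableOn
      (fun y : ℝ => Real.sin (x * y) * Real.exp (-(2 * Real.pi * (n + 1) * y))) (Set.Ioi 0) := by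
    intro n
    refine MeasureTheory.Integrable.mono' ((integrableOn_mul_exp_neg (hpos n)).1.const_mul x)
      (by fun_prop) ?_
    exact (MeasureTheory.ae_restrict_iff' measurableSet_Ioi).2 (.of_forall (hb n))
  have hs : Summable fun n : ℕ => ∫ y in Set.Ioi (0 : ℝ),
      ‖Real.sin (x * y) * Real.exp (-(2 * Real.pi * (n + 1) * y))‖ := by
    have h2 : Summable fun n : ℕ => x * (1 / (2 * Real.pi * (n + 1 : ℝ)) ^ 2) := by
      have := (summable_nat_add_iff 1).2 (Real.summable_one_div_nat_pow.2 (one_lt_two))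
      refine ((this.mul_left (x / (2 * Real.pi) ^ 2)).congr ?_)
      intro n
      push_cast
      field_simp
    refine Summable.of_nonneg_of_le (fun n => by positivity)
      (fun n => ?_) h2
    rw [← (integrableOn_mul_exp_neg (hpos n)).2, ← MeasureTheory.integral_const_mul]
    exact MeasureTheory.setIntegral_mono_on (μ := MeasureTheory.volume) (hint n).norm
      ((integrableOn_mul_exp_neg (hpos n)).1.const_mul x) measurableSet_Ioi (hb n)
  have key := MeasureTheory.hasSum_integral_of_summable_integral_norm hint hs
  simp only [integral_sin_mul_exp_neg x (hpos _)] at key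
  suffices h : ∫ y in Set.Ioi (0 : ℝ), Real.sin (x * y) / (Real.exp (2 * Real.pi * y) - 1)
      = ∫ y in Set.Ioi (0 : ℝ), ∑' n : ℕ,
        Real.sin (x * y) * Real.exp (-(2 * Real.pi * (n + 1) * y)) by rw [h]; exact key
  refine MeasureTheory.setIntegral_congr_fun measurableSet_Ioi fun y hy => ?_
  have hy : 0 < y := hy
  have hq : Real.exp (-(2 * Real.pi * y)) < 1 := by
    rw [Real.exp_lt_one_iff]; simp; positivity
  have hg := (hasSum_geometric_of_lt_one (Real.exp_pos _).le hq).mul_left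
    (Real.sin (x * y) * Real.exp (-(2 * Real.pi * y)))
  have : ∀ n : ℕ, Real.sin (x * y) * Real.exp (-(2 * Real.pi * y)) *
      Real.exp (-(2 * Real.pi * y)) ^ n
      = Real.sin (x * y) * Real.exp (-(2 * Real.pi * (n + 1) * y)) := by
    intro n
    rw [← Real.exp_nat_mul, mul_assoc, ← Real.exp_add]
    congr 2; ring
  simp only [this] at hg
  rw [hg.tsum_eq, Real.exp_neg]
  have h1 : 1 < Real.exp (2 * Real.pi * y) := by
    rw [Real.one_lt_exp_iff]; positivity
  have h2 : Real.exp (2 * Real.pi * y) - 1 ≠ 0 := by linarith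
  have h3 : Real.exp (2 * Real.pi * y) ≠ 0 := by positivity
  field_simp

/-- The geometric expansion of the weight turns the integral into the partial fractions of the
cotangent on the imaginary axis. -/
theorem integral_sin_div_exp_sub_one {x : ℝ} (hx : 0 < x) :
    ∫ y in Set.Ioi (0 : ℝ), Real.sin (x * y) / (Real.exp (2 * Real.pi * y) - 1)
      = Real.cosh (x / 2) / (4 * Real.sinh (x / 2)) - 1 / (2 * x) := by
  have hs := hasSum_div_sq_add_sq hx
  set S := ∫ y in Set.Ioi (0 : ℝ), Real.sin (x * y) / (Real.exp (2 * Real.pi * y) - 1)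
  have hpi : (Real.pi : ℂ) ≠ 0 := by exact_mod_cast Real.pi_ne_zero
  have hxc : (x : ℂ) ≠ 0 := by exact_mod_cast hx.ne'
  -- At this point each pair 1/(z-n) + 1/(z+n) is -4πi times x/(x²+(2πn)²), and πz = ix/2.
  set z : ℂ := (x : ℂ) / (2 * Real.pi) * Complex.I with hz
  have hzre : z.im ≠ 0 := by
    have : z = ((x / (2 * Real.pi) : ℝ) : ℂ) * Complex.I := by rw [hz]; push_cast; rfl
    rw [this, Complex.im_ofReal_mul, Complex.I_im, mul_one]
    positivity
  have hzc : z ∈ Complex.integerComplement := by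
    rintro ⟨n, hn⟩
    exact hzre (by rw [← hn]; simp)
  have hcot := cot_series_rep hzc
  have hterm : ∀ n : ℕ, 1 / (z - ((n : ℂ) + 1)) + 1 / (z + ((n : ℂ) + 1))
      = (-(4 * Real.pi * Complex.I)) * ((x / (x ^ 2 + (2 * Real.pi * (n + 1)) ^ 2) : ℝ) : ℂ) := by
    intro n
    have ha : z - ((n : ℂ) + 1) ≠ 0 := by
      intro h; apply hzre; rw [sub_eq_zero.1 h]; simp
    have hb : z + ((n : ℂ) + 1) ≠ 0 := by
      intro h; apply hzre; rw [eq_neg_of_add_eq_zero_left h]; simp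
    have hc : (x : ℂ) ^ 2 + (2 * Real.pi * (n + 1)) ^ 2 ≠ 0 := by
      have : (0 : ℝ) < x ^ 2 + (2 * Real.pi * (n + 1)) ^ 2 := by positivity
      exact_mod_cast this.ne'
    push_cast
    have hzz : z ^ 2 = -((x : ℂ) ^ 2 / (2 * Real.pi) ^ 2) := by
      rw [hz, mul_pow, Complex.I_sq]; ring
    have hd : (z - ((n : ℂ) + 1)) * (z + ((n : ℂ) + 1))
        = -(((x : ℂ) ^ 2 + (2 * Real.pi * (n + 1)) ^ 2) / (2 * Real.pi) ^ 2) := by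
      have : (z - ((n : ℂ) + 1)) * (z + ((n : ℂ) + 1)) = z ^ 2 - (n + 1) ^ 2 := by ring
      rw [this, hzz]
      field_simp
      ring
    rw [div_add_div _ _ ha hb, hd]
    have : 1 * (z + ((n : ℂ) + 1)) + (z - ((n : ℂ) + 1)) * 1 = 2 * z := by ring
    rw [this, hz]
    field_simp
    ring
  have hsum : HasSum (fun n : ℕ => 1 / (z - ((n : ℂ) + 1)) + 1 / (z + ((n : ℂ) + 1)))
      (-(4 * Real.pi * Complex.I) * (S : ℂ)) := by
    simp only [hterm]
    exact (Complex.hasSum_ofReal.2 hs).mul_left _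
  have htsum : ∑' n : ℕ+, (1 / (z - ((n : ℕ) : ℂ)) + 1 / (z + ((n : ℕ) : ℂ)))
      = -(4 * Real.pi * Complex.I) * (S : ℂ) := by
    rw [tsum_pnat_eq_tsum_succ (f := fun n : ℕ => 1 / (z - (n : ℂ)) + 1 / (z + (n : ℂ)))]
    push_cast
    exact hsum.tsum_eq
  rw [htsum] at hcot
  have hpz : (Real.pi : ℂ) * z = ((x / 2 : ℝ) : ℂ) * Complex.I := by
    rw [hz]; push_cast; field_simp
  have hsinh : Real.sinh (x / 2) ≠ 0 := by
    rw [Ne, Real.sinh_eq_zero]; positivity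
  have hsinhc : Complex.sinh ((x / 2 : ℝ) : ℂ) ≠ 0 := by
    rw [← Complex.ofReal_sinh]; exact_mod_cast hsinh
  rw [hpz, Complex.cot, Complex.cos_mul_I, Complex.sin_mul_I] at hcot
  have hz1 : 1 / z = -(2 * Real.pi * Complex.I) / x := by
    rw [hz]; field_simp; rw [Complex.I_sq, neg_neg]
  rw [hz1] at hcot
  have hlhs : Complex.cosh ((x / 2 : ℝ) : ℂ) / (Complex.sinh ((x / 2 : ℝ) : ℂ) * Complex.I)
      = -Complex.I * (Complex.cosh ((x / 2 : ℝ) : ℂ) / Complex.sinh ((x / 2 : ℝ) : ℂ)) := by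
    field_simp; rw [Complex.I_sq]; ring
  rw [hlhs] at hcot
  have hfin : Complex.cosh ((x / 2 : ℝ) : ℂ) / Complex.sinh ((x / 2 : ℝ) : ℂ)
      = 2 / x + 4 * S := by
    have hne : -(Real.pi * Complex.I) ≠ 0 := by simp [hpi]
    apply mul_left_cancel₀ hne
    linear_combination hcot
  rw [← Complex.ofReal_sinh, ← Complex.ofReal_cosh] at hfin
  have hfin' : Real.cosh (x / 2) / Real.sinh (x / 2) = 2 / x + 4 * S := by exact_mod_cast hfin
  have : Real.cosh (x / 2) / (4 * Real.sinh (x / 2)) = (2 / x + 4 * S) / 4 := by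
    rw [← hfin']; field_simp
  rw [this]; field_simp; ring

theorem integrableOn_sin_div_exp_sub_one (x : ℝ) :
    MeasureTheory.IntegrableOn
      (fun y : ℝ => Real.sin (x * y) / (Real.exp (2 * Real.pi * y) - 1)) (Set.Ioi 0) := by
  have h1 : MeasureTheory.IntegrableOn (fun y : ℝ => |x| * Real.exp (-y)) (Set.Ioi 0) := by
    have := (integrableOn_exp_mul_Ioi (a := -1) (by simp) 0).const_mul |x|
    simpa [MeasureTheory.IntegrableOn] using this
  refine MeasureTheory.Integrable.mono' h1
    (Measurable.aestronglyMeasurable (by fun_prop)) ?_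
  refine (MeasureTheory.ae_restrict_iff' measurableSet_Ioi).2 (.of_forall fun y hy => ?_)
  have hy : 0 < y := hy
  have hsin : |Real.sin (x * y)| ≤ |x| * y := by
    have := Real.abs_sin_le_abs (x := x * y)
    rwa [abs_mul, abs_of_pos hy] at this
  have hexp : y * Real.exp y ≤ Real.exp (2 * Real.pi * y) - 1 := by
    have h2 : Real.exp y * Real.exp y ≤ Real.exp (2 * Real.pi * y) := by
      rw [← Real.exp_add, Real.exp_le_exp]
      nlinarith [Real.pi_gt_three]
    have h3 := Real.add_one_le_exp y
    nlinarith [Real.exp_pos y]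
  have hpos : 0 < Real.exp (2 * Real.pi * y) - 1 := by
    have : 0 < y * Real.exp y := by positivity
    linarith
  rw [Real.norm_eq_abs, abs_div, abs_of_pos hpos, div_le_iff₀ hpos]
  calc |Real.sin (x * y)| ≤ |x| * y := hsin
    _ = |x| * Real.exp (-y) * (y * Real.exp y) := by
      rw [Real.exp_neg]; field_simp
    _ ≤ _ := by gcongr

/-- The weight `1 / (e^{2πy} + 1)`. -/
noncomputable def fermiWeight (y : ℝ) : ℝ := (Real.exp (2 * Real.pi * y) + 1)⁻¹

/-- With q = e^{2πy}, 1/(q+1) = 1/(q-1) - 2/(q²-1), and the second term is the first transform at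
x/2 after y ↦ 2y. -/
theorem integral_sin_mul_fermiWeight {x : ℝ} (hx : 0 < x) :
    ∫ y in Set.Ioi (0 : ℝ), Real.sin (x * y) * fermiWeight y
      = 1 / (2 * x) - 1 / (4 * Real.sinh (x / 2)) := by
  have hA := integral_sin_div_exp_sub_one hx
  have hB := integral_sin_div_exp_sub_one (half_pos hx)
  have hc := MeasureTheory.integral_comp_mul_left_Ioi
    (fun y => Real.sin (x / 2 * y) / (Real.exp (2 * Real.pi * y) - 1)) 0 (b := 2) two_pos
  rw [mul_zero, hB] at hc
  have hi2 : MeasureTheory.IntegrableOn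
      (fun y : ℝ => Real.sin (x / 2 * (2 * y)) / (Real.exp (2 * Real.pi * (2 * y)) - 1))
      (Set.Ioi 0) := by
    have := (MeasureTheory.integrableOn_Ioi_comp_mul_left_iff
      (fun y => Real.sin (x / 2 * y) / (Real.exp (2 * Real.pi * y) - 1)) 0 (a := 2) two_pos).2
    rw [mul_zero] at this
    exact this (integrableOn_sin_div_exp_sub_one _)
  have heq : ∫ y in Set.Ioi (0 : ℝ), Real.sin (x * y) * fermiWeight y
      = ∫ y in Set.Ioi (0 : ℝ), (Real.sin (x * y) / (Real.exp (2 * Real.pi * y) - 1)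
        - 2 * (Real.sin (x / 2 * (2 * y)) / (Real.exp (2 * Real.pi * (2 * y)) - 1))) := by
    refine MeasureTheory.setIntegral_congr_fun measurableSet_Ioi fun y hy => ?_
    have hy : 0 < y := hy
    have h1 : 1 < Real.exp (2 * Real.pi * y) := by
      rw [Real.one_lt_exp_iff]; positivity
    have h2 : Real.exp (2 * Real.pi * (2 * y)) = Real.exp (2 * Real.pi * y) ^ 2 := by
      rw [← Real.exp_nat_mul]; congr 1; push_cast; ring
    have h3 : x / 2 * (2 * y) = x * y := by ring
    simp only [fermiWeight, h2, h3]
    set q := Real.exp (2 * Real.pi * y)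
    have : q - 1 ≠ 0 := by linarith
    have : q + 1 ≠ 0 := by linarith
    have : q ^ 2 - 1 ≠ 0 := by nlinarith
    field_simp
    ring
  rw [heq, MeasureTheory.integral_sub (integrableOn_sin_div_exp_sub_one x) (hi2.const_mul 2),
    MeasureTheory.integral_const_mul, hc, hA]
  have hs4 : Real.sinh (x / 2 / 2) ≠ 0 := by rw [Ne, Real.sinh_eq_zero]; positivity
  have hc4 : Real.cosh (x / 2 / 2) ≠ 0 := (Real.cosh_pos _).ne'
  have e : x / 2 = 2 * (x / 2 / 2) := by ring
  have hs : Real.sinh (x / 2) = 2 * Real.sinh (x / 2 / 2) * Real.cosh (x / 2 / 2) := by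
    conv_lhs => rw [e]
    rw [Real.sinh_two_mul]
  have hch : Real.cosh (x / 2) = 2 * Real.cosh (x / 2 / 2) ^ 2 - 1 := by
    conv_lhs => rw [e]
    rw [Real.cosh_two_mul, Real.sinh_sq]; ring
  rw [hs, hch]
  simp only [smul_eq_mul]
  field_simp
  ring

/-! ### Holomorphic dependence of integrals on a parameter -/

section ParametricIntegral
open MeasureTheory

/-- For holomorphic integrands a bound on F alone suffices: Cauchy's estimate on circles of radius
ε/4 bounds the derivative on the ball of radius ε/2. -/
theorem hasDerivAt_integral_of_dominated_holomorphic {α : Type*} [MeasurableSpace α]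
    {μ : Measure α} {F F' : ℂ → α → ℂ} {w₀ : ℂ} {ε : ℝ} (hε : 0 < ε) {g : α → ℝ}
    (hg : Integrable g μ) (hmeas : ∀ w ∈ Metric.ball w₀ ε, AEStronglyMeasurable (F w) μ)
    (hmeas' : AEStronglyMeasurable (F' w₀) μ)
    (hder : ∀ᵐ y ∂μ, ∀ w ∈ Metric.ball w₀ ε, HasDerivAt (fun w => F w y) (F' w y) w)
    (hb : ∀ᵐ y ∂μ, ∀ w ∈ Metric.ball w₀ ε, ‖F w y‖ ≤ g y) :
    HasDerivAt (fun w => ∫ y, F w y ∂μ) (∫ y, F' w₀ y ∂μ) w₀ := by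
  have hε4 : 0 < ε / 4 := by positivity
  have hsub : Metric.ball w₀ (ε / 2) ⊆ Metric.ball w₀ ε := Metric.ball_subset_ball (by linarith)
  refine (hasDerivAt_integral_of_dominated_loc_of_deriv_le (bound := fun y => g y / (ε / 4))
    (Metric.ball_mem_nhds w₀ (half_pos hε)) ?_ ?_ hmeas' ?_ (hg.div_const _) ?_).2
  · filter_upwards [Metric.ball_mem_nhds w₀ hε] with w hw using hmeas w hw
  · refine hg.mono' (hmeas w₀ (Metric.mem_ball_self hε)) ?_
    filter_upwards [hb] with y hy using hy w₀ (Metric.mem_ball_self hε)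
  · filter_upwards [hder, hb] with y hy hby w hw
    have hcl : Metric.closedBall w (ε / 4) ⊆ Metric.ball w₀ ε := by
      intro v hv
      have h1 := Metric.mem_closedBall.1 hv
      have h2 := Metric.mem_ball.1 hw
      have h3 := dist_triangle v w w₀
      exact Metric.mem_ball.2 (by linarith)
    rw [← (hy w (hsub hw)).deriv]
    refine Complex.norm_deriv_le_of_forall_mem_sphere_norm_le hε4 ?_ fun z hz =>
      hby z (hcl (Metric.sphere_subset_closedBall hz))
    refine DifferentiableOn.diffContOnCl fun z hz => ?_
    rw [closure_ball _ hε4.ne'] at hz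
    exact (hy z (hcl hz)).differentiableAt.differentiableWithinAt
  · filter_upwards [hder] with y hy w hw using hy w (hsub hw)

end ParametricIntegral

/-! ### Growth of powers and logarithms, decay of the weight -/

section Growth

theorem pow_le_factorial_mul_exp (n : ℕ) {x : ℝ} (hx : 0 ≤ x) :
    x ^ n ≤ (n.factorial : ℝ) * Real.exp x := by
  have := Real.pow_div_factorial_le_exp x hx n
  rw [div_le_iff₀ (by positivity)] at this
  linarith

/-- The constant is uniform in ‖w‖ ≤ n, as differentiation in w under the integral requires. The
factor e^{nπ} absorbs the argument; δ^{-n} covers small |z| and n!·e^{|z|} large |z|. -/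
theorem exists_norm_cpow_neg_le (n : ℕ) {δ : ℝ} (hδ : 0 < δ) :
    ∃ C : ℝ, 0 ≤ C ∧ ∀ w : ℂ, ‖w‖ ≤ n → ∀ z : ℂ, δ ≤ ‖z‖ →
      ‖z ^ (-w)‖ ≤ C * Real.exp ‖z‖ := by
  refine ⟨Real.exp (n * Real.pi) * (n.factorial + (δ ^ n)⁻¹), by positivity, fun w hw z hz => ?_⟩
  have hz0 : 0 < ‖z‖ := hδ.trans_le hz
  have hzne : z ≠ 0 := norm_pos_iff.1 hz0
  rw [Complex.cpow_def_of_ne_zero hzne, Complex.norm_exp]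
  have hre : (Complex.log z * -w).re ≤ n * |Real.log ‖z‖| + n * Real.pi := by
    simp only [mul_neg, Complex.neg_re, Complex.mul_re, Complex.log_re, Complex.log_im]
    have h1 : |Real.log ‖z‖ * w.re| ≤ n * |Real.log ‖z‖| := by
      rw [abs_mul, mul_comm]
      gcongr
      exact (Complex.abs_re_le_norm w).trans hw
    have h2 : |z.arg * w.im| ≤ n * Real.pi := by
      rw [abs_mul, mul_comm]
      gcongr
      · exact (Complex.abs_im_le_norm w).trans hw
      · exact Complex.abs_arg_le_pi z
    have := neg_abs_le (Real.log ‖z‖ * w.re)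
    have := le_abs_self (z.arg * w.im)
    linarith
  have hlog : Real.exp (n * |Real.log ‖z‖|) ≤ ‖z‖ ^ n + (δ ^ n)⁻¹ := by
    have hinv : (‖z‖ ^ n)⁻¹ ≤ (δ ^ n)⁻¹ := by gcongr
    have hp : 0 ≤ ‖z‖ ^ n := by positivity
    have hd : 0 ≤ (δ ^ n)⁻¹ := by positivity
    rw [Real.exp_nat_mul]
    rcases abs_cases (Real.log ‖z‖) with ⟨h, _⟩ | ⟨h, _⟩
    · rw [h, Real.exp_log hz0]; linarith
    · rw [h, Real.exp_neg, Real.exp_log hz0, inv_pow]; linarith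
  calc Real.exp (Complex.log z * -w).re
      ≤ Real.exp (n * |Real.log ‖z‖| + n * Real.pi) := Real.exp_le_exp.2 hre
    _ = Real.exp (n * Real.pi) * Real.exp (n * |Real.log ‖z‖|) := by rw [Real.exp_add]; ring
    _ ≤ Real.exp (n * Real.pi) * (‖z‖ ^ n + (δ ^ n)⁻¹) := by gcongr
    _ ≤ Real.exp (n * Real.pi) * (n.factorial * Real.exp ‖z‖ + (δ ^ n)⁻¹ * Real.exp ‖z‖) := by
      gcongr
      · exact pow_le_factorial_mul_exp n hz0.le
      · exact le_mul_of_one_le_right (by positivity) (Real.one_le_exp hz0.le)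
    _ = _ := by ring

theorem exists_norm_pow_mul_log_le (k : ℕ) {δ : ℝ} (hδ : 0 < δ) :
    ∃ C : ℝ, 0 ≤ C ∧ ∀ z : ℂ, δ ≤ ‖z‖ → ‖z ^ k * Complex.log z‖ ≤ C * Real.exp ‖z‖ := by
  refine ⟨(k + 1).factorial + k.factorial * (δ⁻¹ + Real.pi), by positivity, fun z hz => ?_⟩
  have hz0 : 0 < ‖z‖ := hδ.trans_le hz
  have h1 : ‖Complex.log z‖ ≤ ‖z‖ + (δ⁻¹ + Real.pi) := by
    have h := Complex.norm_le_abs_re_add_abs_im (Complex.log z)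
    rw [Complex.log_re, Complex.log_im] at h
    have h2 := Complex.abs_arg_le_pi z
    have h3 : |Real.log ‖z‖| ≤ ‖z‖ + δ⁻¹ := by
      have ha := Real.log_le_self hz0.le
      have hb := Real.log_le_self (inv_pos.2 hz0).le
      rw [Real.log_inv] at hb
      have hc : ‖z‖⁻¹ ≤ δ⁻¹ := by gcongr
      have hd : 0 < δ⁻¹ := by positivity
      rw [abs_le]; constructor <;> linarith
    linarith
  rw [norm_mul, norm_pow]
  calc ‖z‖ ^ k * ‖Complex.log z‖ ≤ ‖z‖ ^ k * (‖z‖ + (δ⁻¹ + Real.pi)) := by gcongr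
    _ = ‖z‖ ^ (k + 1) + ‖z‖ ^ k * (δ⁻¹ + Real.pi) := by ring
    _ ≤ (k + 1).factorial * Real.exp ‖z‖ + k.factorial * Real.exp ‖z‖ * (δ⁻¹ + Real.pi) := by
      gcongr
      · exact pow_le_factorial_mul_exp _ hz0.le
      · exact pow_le_factorial_mul_exp _ hz0.le
    _ = _ := by ring

theorem fermiWeight_pos (y : ℝ) : 0 < fermiWeight y := by unfold fermiWeight; positivity

theorem continuous_fermiWeight : Continuous fermiWeight := by
  unfold fermiWeight
  refine Continuous.inv₀ (by fun_prop) fun y => by positivity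

/-- The rate 6 < 2π leaves room for two factors of exponential type 1 and a factor y. -/
theorem fermiWeight_le {y : ℝ} (hy : 0 ≤ y) : fermiWeight y ≤ Real.exp (-(6 * y)) := by
  unfold fermiWeight
  rw [Real.exp_neg]
  gcongr
  have : Real.exp (6 * y) ≤ Real.exp (2 * Real.pi * y) := by
    rw [Real.exp_le_exp]; nlinarith [Real.pi_gt_three]
  linarith

end Growth

/-- The Hermite (Abel-Plana) integral `∫_0^∞ (h(t + iy) - h(t - iy)) / (e^{2πy} + 1) dy`. -/
noncomputable def hermiteInt (h : ℂ → ℂ) (t : ℂ) : ℂ :=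
  ∫ y in Set.Ioi (0 : ℝ), (h (t + y * Complex.I) - h (t - y * Complex.I)) * (fermiWeight y : ℂ)

/-- Exponential type at most `1` on right half planes. -/
def ExpBounded (h : ℂ → ℂ) : Prop :=
  ∀ δ : ℝ, 0 < δ → ∃ C : ℝ, 0 ≤ C ∧ ∀ z : ℂ, δ ≤ z.re → ‖h z‖ ≤ C * Real.exp ‖z‖

/-! ### Convergence and holomorphy of Hermite integrals -/

section HermiteInt
open MeasureTheory

theorem expBounded_cpow_neg (w : ℂ) : ExpBounded (fun z => z ^ (-w)) := by
  intro δ hδ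
  obtain ⟨n, hn⟩ := exists_nat_ge ‖w‖
  obtain ⟨C, hC, h⟩ := exists_norm_cpow_neg_le n hδ
  exact ⟨C, hC, fun z hz => h w hn z (hz.trans (Complex.re_le_norm z))⟩

theorem expBounded_pow_mul_log (k : ℕ) : ExpBounded (fun z => z ^ k * Complex.log z) := by
  intro δ hδ
  obtain ⟨C, hC, h⟩ := exists_norm_pow_mul_log_le k hδ
  exact ⟨C, hC, fun z hz => h z (hz.trans (Complex.re_le_norm z))⟩

theorem differentiableOn_cpow_neg (w : ℂ) :
    DifferentiableOn ℂ (fun z : ℂ => z ^ (-w)) {z | 0 < z.re} := fun z hz =>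
  ((hasDerivAt_id z).cpow_const (Or.inl hz)).differentiableAt.differentiableWithinAt

theorem differentiableOn_pow_mul_log (k : ℕ) :
    DifferentiableOn ℂ (fun z : ℂ => z ^ k * Complex.log z) {z | 0 < z.re} := fun _ hz =>
  ((differentiableAt_id.pow k).mul
    (Complex.differentiableAt_log (Or.inl hz))).differentiableWithinAt

theorem norm_hermite_integrand_le {C y : ℝ} (hC : 0 ≤ C) (hy : 0 < y) {a b t : ℂ}
    (ha : ‖a‖ ≤ C * Real.exp ‖t + y * Complex.I‖) (hb : ‖b‖ ≤ C * Real.exp ‖t - y * Complex.I‖) :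
    ‖(a - b) * (fermiWeight y : ℂ)‖ ≤ 2 * C * Real.exp ‖t‖ * Real.exp (-y) := by
  have h1 : ‖t + y * Complex.I‖ ≤ ‖t‖ + y := by
    refine (norm_add_le _ _).trans ?_
    simp [abs_of_pos hy]
  have h2 : ‖t - y * Complex.I‖ ≤ ‖t‖ + y := by
    refine (norm_sub_le _ _).trans ?_
    simp [abs_of_pos hy]
  rw [norm_mul, Complex.norm_real, Real.norm_of_nonneg (fermiWeight_pos y).le]
  have hab : ‖a - b‖ ≤ 2 * C * Real.exp (‖t‖ + y) := by
    calc ‖a - b‖ ≤ ‖a‖ + ‖b‖ := norm_sub_le _ _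
      _ ≤ C * Real.exp (‖t‖ + y) + C * Real.exp (‖t‖ + y) := by
        refine add_le_add (ha.trans ?_) (hb.trans ?_) <;> gcongr
      _ = _ := by ring
  calc ‖a - b‖ * fermiWeight y ≤ 2 * C * Real.exp (‖t‖ + y) * Real.exp (-(6 * y)) :=
        mul_le_mul hab (fermiWeight_le hy.le) (fermiWeight_pos y).le (by positivity)
    _ = 2 * C * Real.exp ‖t‖ * Real.exp (-(5 * y)) := by
      rw [mul_assoc, mul_assoc (2 * C) (Real.exp ‖t‖), ← Real.exp_add, ← Real.exp_add]
      congr 2; ring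
    _ ≤ _ := by
      gcongr; linarith

theorem continuousOn_hermite_integrand {h : ℂ → ℂ} (hh : ContinuousOn h {z | 0 < z.re}) {t : ℂ}
    (ht : 0 < t.re) : Continuous fun y : ℝ =>
      (h (t + y * Complex.I) - h (t - y * Complex.I)) * (fermiWeight y : ℂ) := by
  have h1 : Continuous fun y : ℝ => h (t + y * Complex.I) :=
    hh.comp_continuous (by fun_prop) fun y => by simpa using ht
  have h2 : Continuous fun y : ℝ => h (t - y * Complex.I) :=
    hh.comp_continuous (by fun_prop) fun y => by simpa using ht
  exact (h1.sub h2).mul (Complex.continuous_ofReal.comp continuous_fermiWeight)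

theorem integrableOn_hermite_integrand {h : ℂ → ℂ} (hh : ContinuousOn h {z | 0 < z.re})
    (hb : ExpBounded h) {t : ℂ} (ht : 0 < t.re) : IntegrableOn (fun y : ℝ =>
      (h (t + y * Complex.I) - h (t - y * Complex.I)) * (fermiWeight y : ℂ)) (Set.Ioi 0) := by
  obtain ⟨C, hC, hCb⟩ := hb t.re ht
  refine Integrable.mono' ((integrableOn_exp_neg_Ioi 0).const_mul (2 * C * Real.exp ‖t‖))
    (continuousOn_hermite_integrand hh ht).aestronglyMeasurable ?_
  refine (ae_restrict_iff' measurableSet_Ioi).2 (.of_forall fun y hy => ?_)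
  exact norm_hermite_integrand_le hC hy (hCb _ (by simp)) (hCb _ (by simp))

theorem differentiableOn_hermiteInt {h : ℂ → ℂ} (hh : DifferentiableOn ℂ h {z | 0 < z.re})
    (hb : ExpBounded h) : DifferentiableOn ℂ (hermiteInt h) {z | 0 < z.re} := by
  have hopen : IsOpen {z : ℂ | 0 < z.re} := isOpen_lt continuous_const Complex.continuous_re
  have hda : ∀ z : ℂ, 0 < z.re → HasDerivAt h (deriv h z) z := fun z hz =>
    (hh.differentiableAt (hopen.mem_nhds hz)).hasDerivAt
  intro t ht
  have ht : 0 < t.re := ht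
  obtain ⟨C, hC, hCb⟩ := hb (t.re / 2) (half_pos ht)
  have hre : ∀ w ∈ Metric.ball t (t.re / 2), t.re / 2 ≤ w.re := by
    intro w hw
    have h1 := (Complex.abs_re_le_norm (w - t)).trans (mem_ball_iff_norm.1 hw).le
    rw [Complex.sub_re, abs_le] at h1
    linarith
  have hderiv : ContinuousOn (deriv h) {z | 0 < z.re} := (hh.deriv hopen).continuousOn
  refine HasDerivAt.differentiableAt (f' := ∫ y in Set.Ioi (0 : ℝ),
    (deriv h (t + y * Complex.I) - deriv h (t - y * Complex.I)) * (fermiWeight y : ℂ)) ?_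
    |>.differentiableWithinAt
  refine hasDerivAt_integral_of_dominated_holomorphic (half_pos ht)
    (F' := fun w (y : ℝ) => (deriv h (w + y * Complex.I) - deriv h (w - y * Complex.I)) *
      (fermiWeight y : ℂ))
    (g := fun y : ℝ => 2 * C * Real.exp (‖t‖ + t.re / 2) * Real.exp (-y))
    ((integrableOn_exp_neg_Ioi 0).const_mul _) ?_ ?_ ?_ ?_
  · intro w hw
    exact (continuousOn_hermite_integrand hh.continuousOn
      ((half_pos ht).trans_le (hre w hw))).aestronglyMeasurable
  · exact (continuousOn_hermite_integrand hderiv ht).aestronglyMeasurable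
  · refine .of_forall fun y w hw => ?_
    have hw0 := (half_pos ht).trans_le (hre w hw)
    have h1 := (hda (w + y * Complex.I) (by simpa using hw0)).comp_add_const w (y * Complex.I)
    have h2 := (hda (w - y * Complex.I) (by simpa using hw0)).comp_sub_const w (y * Complex.I)
    exact (h1.sub h2).mul_const _
  · refine (ae_restrict_iff' measurableSet_Ioi).2 (.of_forall fun y hy w hw => ?_)
    refine (norm_hermite_integrand_le hC hy (hCb _ (by simpa using hre w hw))
      (hCb _ (by simpa using hre w hw))).trans ?_
    gcongr
    have := norm_sub_norm_le w t
    have := (mem_ball_iff_norm.1 hw).le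
    linarith

theorem hasDerivAt_hermiteInt_cpow_neg {t : ℂ} (ht : 0 < t.re) (w₀ : ℂ) :
    HasDerivAt (fun w => hermiteInt (fun z => z ^ (-w)) t)
      (hermiteInt (fun z => -(z ^ (-w₀) * Complex.log z)) t) w₀ := by
  obtain ⟨n, hn⟩ := exists_nat_ge (‖w₀‖ + 1)
  obtain ⟨C, hC, hCb⟩ := exists_norm_cpow_neg_le n ht
  refine hasDerivAt_integral_of_dominated_holomorphic one_pos
    (F' := fun w (y : ℝ) => (-((t + y * Complex.I) ^ (-w) * Complex.log (t + y * Complex.I)) -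
      -((t - y * Complex.I) ^ (-w) * Complex.log (t - y * Complex.I))) * (fermiWeight y : ℂ))
    (g := fun y : ℝ => 2 * C * Real.exp ‖t‖ * Real.exp (-y))
    ((integrableOn_exp_neg_Ioi 0).const_mul _) ?_ ?_ ?_ ?_
  · intro w _
    exact (continuousOn_hermite_integrand
      (differentiableOn_cpow_neg w).continuousOn ht).aestronglyMeasurable
  · refine (continuousOn_hermite_integrand (h := fun z => -(z ^ (-w₀) * Complex.log z)) ?_
      ht).aestronglyMeasurable
    refine ((differentiableOn_cpow_neg w₀).continuousOn.mul fun z hz => ?_).neg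
    exact (Complex.differentiableAt_log (Or.inl hz)).continuousAt.continuousWithinAt
  · refine .of_forall fun y w _ => ?_
    have hd : ∀ z : ℂ, 0 < z.re →
        HasDerivAt (fun w => z ^ (-w)) (-(z ^ (-w) * Complex.log z)) w := by
      intro z hz
      have hz0 : z ≠ 0 := by rintro rfl; simp at hz
      have := (hasDerivAt_neg w).const_cpow (c := z) (Or.inl hz0)
      simpa using this
    exact ((hd _ (by simpa using ht)).sub (hd _ (by simpa using ht))).mul_const _
  · refine (ae_restrict_iff' measurableSet_Ioi).2 (.of_forall fun y hy w hw => ?_)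
    have hwn : ‖w‖ ≤ n := by
      have := norm_sub_norm_le w w₀
      have := (mem_ball_iff_norm.1 hw).le
      linarith
    refine norm_hermite_integrand_le hC hy (hCb w hwn _ ?_) (hCb w hwn _ ?_)
    · simpa using Complex.re_le_norm (t + y * Complex.I)
    · simpa using Complex.re_le_norm (t - y * Complex.I)

end HermiteInt

/-! ### The Gamma integral with complex rate -/

section LaplaceGamma
open MeasureTheory

theorem integrableOn_rpow_mul_exp_neg {s b : ℝ} (hs : 0 < s) (hb : 0 < b) :
    IntegrableOn (fun x : ℝ => x ^ (s - 1) * Real.exp (-(b * x))) (Set.Ioi 0) := by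
  by_contra hn
  have h := Real.integral_rpow_mul_exp_neg_mul_Ioi hs hb
  rw [integral_undef hn] at h
  have : 0 < (1 / b) ^ s * Real.Gamma s := mul_pos (by positivity) (Real.Gamma_pos_of_pos hs)
  linarith

theorem norm_cpow_mul_exp_neg {w r : ℂ} {x : ℝ} (hx : 0 < x) :
    ‖(x : ℂ) ^ (w - 1) * Complex.exp (-(r * x))‖ = x ^ (w.re - 1) * Real.exp (-(r.re * x)) := by
  rw [norm_mul, Complex.norm_cpow_eq_rpow_re_of_pos hx, Complex.norm_exp]
  simp

theorem continuousOn_cpow_mul_exp_neg (w r : ℂ) :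
    ContinuousOn (fun x : ℝ => (x : ℂ) ^ (w - 1) * Complex.exp (-(r * x))) (Set.Ioi 0) := by
  refine ContinuousOn.mul (fun x hx => ?_) (by fun_prop)
  exact (Complex.continuousAt_ofReal_cpow_const x (w - 1)
    (Or.inr (ne_of_gt hx))).continuousWithinAt

theorem integrableOn_cpow_mul_exp_neg {w r : ℂ} (hw : 0 < w.re) (hr : 0 < r.re) :
    IntegrableOn (fun x : ℝ => (x : ℂ) ^ (w - 1) * Complex.exp (-(r * x))) (Set.Ioi 0) := by
  refine Integrable.mono' (integrableOn_rpow_mul_exp_neg hw hr)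
    ((continuousOn_cpow_mul_exp_neg w r).aestronglyMeasurable measurableSet_Ioi) ?_
  exact (ae_restrict_iff' measurableSet_Ioi).2 (.of_forall fun x hx =>
    (norm_cpow_mul_exp_neg hx).le)

/-- Both sides are holomorphic in r on the right half plane and agree for real r > 0, so the
identity theorem applies. -/
theorem integral_cpow_mul_exp_neg_complex {w r : ℂ} (hw : 0 < w.re) (hr : 0 < r.re) :
    ∫ x in Set.Ioi (0 : ℝ), (x : ℂ) ^ (w - 1) * Complex.exp (-(r * x))
      = Complex.Gamma w * r ^ (-w) := by
  have hopen : IsOpen {z : ℂ | 0 < z.re} := isOpen_lt continuous_const Complex.continuous_re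
  have hF : DifferentiableOn ℂ (fun r : ℂ =>
      ∫ x in Set.Ioi (0 : ℝ), (x : ℂ) ^ (w - 1) * Complex.exp (-(r * x))) {z | 0 < z.re} := by
    intro r hr
    have hr : 0 < r.re := hr
    have hre : ∀ v ∈ Metric.ball r (r.re / 2), r.re / 2 ≤ v.re := by
      intro v hv
      have h1 := (Complex.abs_re_le_norm (v - r)).trans (mem_ball_iff_norm.1 hv).le
      rw [Complex.sub_re, abs_le] at h1
      linarith
    refine (hasDerivAt_integral_of_dominated_holomorphic (half_pos hr)
      (F' := fun v (x : ℝ) => (x : ℂ) ^ (w - 1) * (Complex.exp (-(v * x)) * -x))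
      (integrableOn_rpow_mul_exp_neg hw (half_pos hr)) ?_ ?_ ?_ ?_).differentiableAt
      |>.differentiableWithinAt
    · intro v _
      exact (continuousOn_cpow_mul_exp_neg w v).aestronglyMeasurable measurableSet_Ioi
    · refine ContinuousOn.aestronglyMeasurable ?_ measurableSet_Ioi
      have := (continuousOn_cpow_mul_exp_neg w r).mul
        (g := fun x : ℝ => -(x : ℂ)) (by fun_prop)
      exact this.congr fun x _ => by simp [mul_assoc]
    · refine .of_forall fun x v _ => ?_
      have : HasDerivAt (fun v : ℂ => -(v * x)) (-x) v := by
        simpa using ((hasDerivAt_id v).mul_const (x : ℂ)).fun_neg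
      exact this.cexp.const_mul _
    · refine (ae_restrict_iff' measurableSet_Ioi).2 (.of_forall fun x hx v hv => ?_)
      have hx : 0 < x := hx
      rw [norm_cpow_mul_exp_neg hx]
      gcongr
      exact hre v hv
  have hG : DifferentiableOn ℂ (fun r : ℂ => Complex.Gamma w * r ^ (-w)) {z | 0 < z.re} :=
    (differentiableOn_cpow_neg w).const_mul _
  have hpre : IsPreconnected {z : ℂ | 0 < z.re} := (convex_halfSpace_re_gt 0).isPreconnected
  refine (hF.analyticOnNhd hopen).eqOn_of_preconnected_of_frequently_eq (hG.analyticOnNhd hopen)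
    hpre (z₀ := 1) (by simp) ?_ hr
  have hlim : Filter.Tendsto (fun x : ℝ => (x : ℂ)) (𝓝[≠] 1) (𝓝[≠] 1) := by
    refine tendsto_nhdsWithin_iff.2 ⟨?_, ?_⟩
    · exact (Complex.continuous_ofReal.tendsto' 1 1 (by simp)).mono_left nhdsWithin_le_nhds
    · filter_upwards [self_mem_nhdsWithin] with x hx
      simpa using hx
  refine hlim.frequently (Filter.Eventually.frequently ?_)
  filter_upwards [nhdsWithin_le_nhds (Ioi_mem_nhds (zero_lt_one (α := ℝ)))] with x hx
  have hx : 0 < x := hx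
  rw [Complex.integral_cpow_mul_exp_neg_mul_Ioi hw hx, mul_comm, one_div,
    Complex.inv_cpow _ _ ?_, Complex.cpow_neg]
  rw [Complex.arg_ofReal_of_nonneg hx.le]
  exact Real.pi_pos.ne

end LaplaceGamma

/-- The continuation in `w` of `∑ (N + 1/2 + t)^{-w}`, `Re t > 0`, by Hermite's formula. -/
noncomputable def hurwitzCont (w t : ℂ) : ℂ :=
  t ^ (1 - w) / (w - 1) - Complex.I * hermiteInt (fun z => z ^ (-w)) t

/-! ### Hermite's formula for the half-shifted Hurwitz zeta function -/

section Hermite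
open MeasureTheory

theorem integral_laplace_sin {w t : ℂ} (hw : 0 < w.re) (ht : 0 < t.re) (y : ℝ) :
    ∫ x in Set.Ioi (0 : ℝ), (x : ℂ) ^ (w - 1) * Complex.exp (-(t * x)) * (Real.sin (x * y) : ℂ)
      = Complex.Gamma w * (Complex.I / 2) *
        ((t + y * Complex.I) ^ (-w) - (t - y * Complex.I) ^ (-w)) := by
  have h1 : 0 < (t + y * Complex.I).re := by simpa using ht
  have h2 : 0 < (t - y * Complex.I).re := by simpa using ht
  have e : ∀ x : ℝ, (x : ℂ) ^ (w - 1) * Complex.exp (-(t * x)) * (Real.sin (x * y) : ℂ)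
      = (Complex.I / 2) * ((x : ℂ) ^ (w - 1) * Complex.exp (-((t + y * Complex.I) * x)) -
        (x : ℂ) ^ (w - 1) * Complex.exp (-((t - y * Complex.I) * x))) := by
    intro x
    have a1 : -((t + y * Complex.I) * x) = -(t * x) + -(x * y : ℂ) * Complex.I := by ring
    have a2 : -((t - y * Complex.I) * x) = -(t * x) + (x * y : ℂ) * Complex.I := by ring
    rw [a1, a2, Complex.exp_add, Complex.exp_add, Complex.ofReal_sin, Complex.sin]
    push_cast
    ring
  simp only [e]
  rw [integral_const_mul, integral_sub (integrableOn_cpow_mul_exp_neg hw h1)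
    (integrableOn_cpow_mul_exp_neg hw h2), integral_cpow_mul_exp_neg_complex hw h1,
    integral_cpow_mul_exp_neg_complex hw h2]
  ring

theorem integrableOn_fermiWeight : IntegrableOn fermiWeight (Set.Ioi 0) := by
  refine Integrable.mono' (integrableOn_exp_neg_Ioi 0)
    continuous_fermiWeight.aestronglyMeasurable ?_
  refine (ae_restrict_iff' measurableSet_Ioi).2 (.of_forall fun y hy => ?_)
  have hy : 0 < y := hy
  rw [Real.norm_of_nonneg (fermiWeight_pos y).le]
  refine (fermiWeight_le hy.le).trans (Real.exp_le_exp.2 (by linarith))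

/-- Up to the factor Γ(w)·i/2, the difference of powers at t ± iy is the Mellin-Laplace transform of
sin(xy). Exchanging the x and y integrals leaves the sine transform of the weight, which is known in
closed form. -/
theorem gamma_mul_hurwitzCont {w t : ℂ} (hw : 1 < w.re) (ht : 0 < t.re) :
    Complex.Gamma w * hurwitzCont w t = ∫ x in Set.Ioi (0 : ℝ),
      (x : ℂ) ^ (w - 1) * Complex.exp (-(t * x)) * ((1 / (2 * Real.sinh (x / 2)) : ℝ) : ℂ) := by
  have hw0 : 0 < w.re := by linarith
  have hw1 : 0 < (w - 1).re := by simpa using hw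
  have hwne : w - 1 ≠ 0 := by intro h; rw [h] at hw1; simp at hw1
  have hA := integrableOn_cpow_mul_exp_neg hw0 ht
  have hB := integrableOn_cpow_mul_exp_neg hw1 ht
  have hprod : Integrable (Function.uncurry fun (x y : ℝ) =>
      (x : ℂ) ^ (w - 1) * Complex.exp (-(t * x)) * (Real.sin (x * y) : ℂ) * (fermiWeight y : ℂ))
      ((volume.restrict (Set.Ioi 0)).prod (volume.restrict (Set.Ioi 0))) := by
    have h1 := Integrable.mul_prod hA (integrableOn_fermiWeight.ofReal (𝕜 := ℂ))
    have h2 := h1.bdd_mul (c := 1) (f := fun p : ℝ × ℝ => (Real.sin (p.1 * p.2) : ℂ))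
      (by fun_prop) (.of_forall fun p => by
        rw [Complex.norm_real]; exact Real.abs_sin_le_one _)
    refine h2.congr (.of_forall fun p => ?_)
    simp only [Function.uncurry]
    simp
    ring
  have hswap := integral_integral_swap hprod
  have hinner : ∀ x ∈ Set.Ioi (0 : ℝ), (∫ y in Set.Ioi (0 : ℝ),
      (x : ℂ) ^ (w - 1) * Complex.exp (-(t * x)) * (Real.sin (x * y) : ℂ) * (fermiWeight y : ℂ))
      = (x : ℂ) ^ (w - 1) * Complex.exp (-(t * x)) *
        ((1 / (2 * x) - 1 / (4 * Real.sinh (x / 2)) : ℝ) : ℂ) := by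
    intro x hx
    rw [← integral_sin_mul_fermiWeight hx, ← integral_complex_ofReal, ← integral_const_mul]
    refine integral_congr_ae (.of_forall fun y => ?_)
    simp only
    push_cast
    ring
  have hint := hprod.integral_prod_left
  simp only [Function.uncurry] at hint
  rw [setIntegral_congr_fun measurableSet_Ioi hinner] at hswap
  have hint' : IntegrableOn (fun x : ℝ => (x : ℂ) ^ (w - 1) * Complex.exp (-(t * x)) *
        ((1 / (2 * x) - 1 / (4 * Real.sinh (x / 2)) : ℝ) : ℂ)) (Set.Ioi 0) :=
    IntegrableOn.congr_fun hint hinner measurableSet_Ioi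
  have hright : (∫ y in Set.Ioi (0 : ℝ), ∫ x in Set.Ioi (0 : ℝ),
      (x : ℂ) ^ (w - 1) * Complex.exp (-(t * x)) * (Real.sin (x * y) : ℂ) * (fermiWeight y : ℂ))
      = Complex.Gamma w * (Complex.I / 2) * hermiteInt (fun z => z ^ (-w)) t := by
    rw [hermiteInt, ← integral_const_mul]
    refine integral_congr_ae (.of_forall fun y => ?_)
    simp only
    rw [integral_mul_const, integral_laplace_sin hw0 ht]
    ring
  rw [hright] at hswap
  -- The 1/x part of 1/(2 sinh(x/2)) yields Γ(w-1) t^{1-w}, hence the polar term t^{1-w}/(w-1); its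
  -- convergence at 0 is where Re w > 1 enters.
  have hsplit : ∀ x ∈ Set.Ioi (0 : ℝ), (x : ℂ) ^ (w - 1) * Complex.exp (-(t * x)) *
      ((1 / (2 * Real.sinh (x / 2)) : ℝ) : ℂ)
      = (x : ℂ) ^ (w - 1 - 1) * Complex.exp (-(t * x)) - 2 * ((x : ℂ) ^ (w - 1) *
        Complex.exp (-(t * x)) * ((1 / (2 * x) - 1 / (4 * Real.sinh (x / 2)) : ℝ) : ℂ)) := by
    intro x hx
    have hx0 : (x : ℂ) ≠ 0 := by exact_mod_cast (ne_of_gt hx)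
    rw [Complex.cpow_sub (w - 1) 1 hx0, Complex.cpow_one]
    push_cast
    have : (Complex.sinh (x / 2) : ℂ) ≠ 0 := by
      have h : Real.sinh (x / 2) ≠ 0 := by
        have hx : 0 < x := hx
        rw [Ne, Real.sinh_eq_zero]; positivity
      have h' : ((Real.sinh (x / 2) : ℝ) : ℂ) ≠ 0 := by exact_mod_cast h
      simpa using h'
    field_simp
    ring
  rw [setIntegral_congr_fun measurableSet_Ioi hsplit, integral_sub hB (hint'.const_mul 2),
    integral_const_mul, hswap, integral_cpow_mul_exp_neg_complex hw1 ht, hurwitzCont]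
  have hgam : Complex.Gamma w = (w - 1) * Complex.Gamma (w - 1) := by
    rw [← Complex.Gamma_add_one _ hwne, sub_add_cancel]
  have e1 : (1 : ℂ) - w = -(w - 1) := by ring
  rw [hgam, e1]
  field_simp

/-- Termwise integration of 1/(2 sinh(x/2)) = ∑ e^{-(N+1/2)x}: the half shift is what makes the
kernel odd and the weight 1/(e^{2πy}+1). -/
theorem hasSum_hurwitzCont {w t : ℂ} (hw : 1 < w.re) (ht : 0 < t.re) :
    HasSum (fun N : ℕ => ((N : ℂ) + 1 / 2 + t) ^ (-w)) (hurwitzCont w t) := by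
  have hw0 : 0 < w.re := by linarith
  have hre : ∀ N : ℕ, 0 < ((N : ℂ) + 1 / 2 + t).re := fun N => by
    simp; positivity
  have hs : Summable fun N : ℕ => ∫ x in Set.Ioi (0 : ℝ),
      ‖(x : ℂ) ^ (w - 1) * Complex.exp (-(((N : ℂ) + 1 / 2 + t) * x))‖ := by
    have h1 := ((Real.summable_one_div_nat_add_rpow (1 / 2 + t.re) w.re).2 hw).mul_right
      (Real.Gamma w.re)
    refine h1.congr fun N => ?_
    rw [setIntegral_congr_fun measurableSet_Ioi fun x hx => norm_cpow_mul_exp_neg hx,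
      Real.integral_rpow_mul_exp_neg_mul_Ioi hw0 (hre N), Real.div_rpow (by norm_num) (hre N).le,
      Real.one_rpow, abs_of_pos (by positivity)]
    simp [add_assoc]
  have key := hasSum_integral_of_summable_integral_norm
    (fun N : ℕ => integrableOn_cpow_mul_exp_neg hw0 (hre N)) hs
  have hgne : Complex.Gamma w ≠ 0 := Complex.Gamma_ne_zero_of_re_pos hw0
  have htsum : (∫ x in Set.Ioi (0 : ℝ), ∑' N : ℕ,
      (x : ℂ) ^ (w - 1) * Complex.exp (-(((N : ℂ) + 1 / 2 + t) * x)))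
      = Complex.Gamma w * hurwitzCont w t := by
    rw [gamma_mul_hurwitzCont hw ht]
    refine setIntegral_congr_fun measurableSet_Ioi fun x hx => ?_
    have hx : 0 < x := hx
    have hq : ‖((Real.exp (-x) : ℝ) : ℂ)‖ < 1 := by
      rw [Complex.norm_real, Real.norm_of_nonneg (Real.exp_pos _).le, Real.exp_lt_one_iff]
      linarith
    have hg := (hasSum_geometric_of_norm_lt_one hq).mul_left
      ((x : ℂ) ^ (w - 1) * Complex.exp (-(t * x)) * ((Real.exp (-(x / 2)) : ℝ) : ℂ))
    have e : ∀ N : ℕ, (x : ℂ) ^ (w - 1) * Complex.exp (-(t * x)) *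
        ((Real.exp (-(x / 2)) : ℝ) : ℂ) * ((Real.exp (-x) : ℝ) : ℂ) ^ N
        = (x : ℂ) ^ (w - 1) * Complex.exp (-(((N : ℂ) + 1 / 2 + t) * x)) := by
      intro N
      push_cast
      rw [← Complex.exp_nat_mul, mul_assoc, mul_assoc, ← Complex.exp_add, ← Complex.exp_add]
      congr 2; ring
    simp only [e] at hg
    rw [hg.tsum_eq]
    have hr : Real.exp (-(x / 2)) * (1 - Real.exp (-x))⁻¹ = 1 / (2 * Real.sinh (x / 2)) := by
      have hx2 : Real.exp (-x) = Real.exp (-(x / 2)) ^ 2 := by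
        rw [← Real.exp_nat_mul]; congr 1; push_cast; ring
      have h1 : Real.exp (x / 2) = (Real.exp (-(x / 2)))⁻¹ := by rw [Real.exp_neg, inv_inv]
      have h2 : Real.exp (-(x / 2)) < 1 := by rw [Real.exp_lt_one_iff]; linarith
      have h3 := Real.exp_pos (-(x / 2))
      rw [Real.sinh_eq, h1, hx2]
      set q := Real.exp (-(x / 2))
      have : 1 - q ^ 2 ≠ 0 := by nlinarith
      field_simp
    rw [← hr]
    push_cast
    ring
  rw [htsum] at key
  simp only [integral_cpow_mul_exp_neg_complex hw0 (hre _)] at key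
  exact (hasSum_mul_left_iff hgne).1 key

end Hermite

/-- The linear functional on polynomials with `X ^ k ↦ e k`. -/
noncomputable def coeffSum (e : ℕ → ℂ) : Polynomial ℂ →ₗ[ℂ] ℂ :=
  Polynomial.lsum fun k => e k • LinearMap.id

/-! ### Linear functionals on polynomials and integer shifts of w -/

section CoeffSum
open Polynomial

theorem coeffSum_eq_sum_range (e : ℕ → ℂ) {p : ℂ[X]} {n : ℕ} (hn : p.natDegree < n) :
    coeffSum e p = ∑ k ∈ Finset.range n, p.coeff k * e k := by
  have h : coeffSum e p = p.sum fun k a => e k * a := rfl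
  rw [h, sum_over_range' _ (by simp) n hn]
  simp only [mul_comm]

/-- Used with c = x^{-w}: a polynomial factor p(x) is absorbed into the shifted powers x^{-(w-k)}.
-/
theorem coeffSum_pow_mul (x c : ℂ) (p : ℂ[X]) :
    coeffSum (fun k => x ^ k * c) p = p.eval x * c := by
  rw [coeffSum_eq_sum_range _ (Nat.lt_succ_self _), eval_eq_sum_range, Finset.sum_mul]
  simp only [mul_assoc]

theorem coeffSum_add (e f : ℕ → ℂ) (p : ℂ[X]) :
    coeffSum (fun k => e k + f k) p = coeffSum e p + coeffSum f p := by
  simp only [coeffSum_eq_sum_range _ (Nat.lt_succ_self p.natDegree), mul_add,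
    Finset.sum_add_distrib]

theorem coeffSum_const_mul (c : ℂ) (e : ℕ → ℂ) (p : ℂ[X]) :
    coeffSum (fun k => c * e k) p = c * coeffSum e p := by
  simp only [coeffSum_eq_sum_range _ (Nat.lt_succ_self p.natDegree), Finset.mul_sum]
  exact Finset.sum_congr rfl fun k _ => by ring

variable {G : ℂ → ℂ} (p : ℂ[X])

theorem meromorphic_coeffSum_shift (hG : Meromorphic G) :
    Meromorphic fun w => coeffSum (fun k => G (w - k)) p := by
  intro x
  simp only [coeffSum_eq_sum_range _ (Nat.lt_succ_self p.natDegree)]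
  refine MeromorphicAt.fun_sum fun k _ => (MeromorphicAt.const _ _).mul ?_
  have h : MeromorphicAt G ((fun w : ℂ => w - k) x) := hG _
  exact h.comp_analyticAt (g := fun w : ℂ => w - k) (by fun_prop)

theorem analyticAt_coeffSum_shift (hG : ∀ k : ℕ, AnalyticAt ℂ G (-(k : ℂ))) :
    AnalyticAt ℂ (fun w => coeffSum (fun k => G (w - k)) p) 0 := by
  simp only [coeffSum_eq_sum_range _ (Nat.lt_succ_self p.natDegree)]
  refine Finset.analyticAt_fun_sum _ fun k _ => analyticAt_const.mul ?_
  have h : AnalyticAt ℂ G ((fun w : ℂ => w - k) 0) := by simpa using hG k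
  exact h.fun_comp (f := fun w : ℂ => w - k) (by fun_prop)

theorem hasDerivAt_coeffSum_shift {G' : ℕ → ℂ} (hG : ∀ k : ℕ, HasDerivAt G (G' k) (-(k : ℂ))) :
    HasDerivAt (fun w => coeffSum (fun k => G (w - k)) p) (coeffSum G' p) 0 := by
  simp only [coeffSum_eq_sum_range _ (Nat.lt_succ_self p.natDegree)]
  refine HasDerivAt.fun_sum fun k _ => HasDerivAt.const_mul _ ?_
  have h : HasDerivAt G (G' k) (0 - (k : ℂ)) := by simpa using hG k
  exact h.comp_sub_const 0 (k : ℂ)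

end CoeffSum

/-! ### Derivatives of the Hurwitz function at w = -k -/

section HurwitzContinuation

/-- The derivative of `hurwitzCont · t` at `-k`. -/
noncomputable def hurwitzContDeriv (t : ℂ) (k : ℕ) : ℂ :=
  t ^ (k + 1) * (Complex.log t / (k + 1) - 1 / ((k : ℂ) + 1) ^ 2) +
    Complex.I * hermiteInt (fun z => z ^ k * Complex.log z) t

variable {t : ℂ}

theorem differentiable_hermiteInt_cpow_neg (ht : 0 < t.re) :
    Differentiable ℂ fun w : ℂ => hermiteInt (fun z => z ^ (-w)) t := fun w =>
  (hasDerivAt_hermiteInt_cpow_neg ht w).differentiableAt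

theorem analyticAt_cpow_linear (ht : t ≠ 0) (a b x : ℂ) :
    AnalyticAt ℂ (fun w => t ^ (a + b * w)) x := by
  have : Differentiable ℂ fun w : ℂ => t ^ (a + b * w) := by
    intro w
    exact DifferentiableAt.const_cpow (by fun_prop) (Or.inl ht)
  exact this.analyticAt x

theorem meromorphic_hurwitzCont (ht : 0 < t.re) : Meromorphic fun w => hurwitzCont w t := by
  intro x
  have ht0 : t ≠ 0 := by rintro rfl; simp at ht
  have h1 : AnalyticAt ℂ (fun w => t ^ (1 - w)) x := by
    simpa [sub_eq_add_neg] using analyticAt_cpow_linear ht0 1 (-1) x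
  have h2 : AnalyticAt ℂ (fun w : ℂ => w - 1) x := by fun_prop
  exact (h1.meromorphicAt.div h2.meromorphicAt).sub
    (analyticAt_const.mul ((differentiable_hermiteInt_cpow_neg ht).analyticAt x)).meromorphicAt

theorem analyticAt_hurwitzCont (ht : 0 < t.re) {x : ℂ} (hx : x ≠ 1) :
    AnalyticAt ℂ (fun w => hurwitzCont w t) x := by
  have ht0 : t ≠ 0 := by rintro rfl; simp at ht
  have h1 : AnalyticAt ℂ (fun w => t ^ (1 - w)) x := by
    simpa [sub_eq_add_neg] using analyticAt_cpow_linear ht0 1 (-1) x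
  have h2 : AnalyticAt ℂ (fun w : ℂ => w - 1) x := by fun_prop
  exact (h1.div h2 (sub_ne_zero.2 hx)).sub
    (analyticAt_const.mul ((differentiable_hermiteInt_cpow_neg ht).analyticAt x))

theorem neg_natCast_ne_one (k : ℕ) : -(k : ℂ) ≠ 1 := by
  intro h
  have h1 : (k : ℂ) + 1 = 0 := by linear_combination -h
  exact Nat.cast_add_one_ne_zero k h1

theorem hasDerivAt_hurwitzCont (ht : 0 < t.re) (k : ℕ) :
    HasDerivAt (fun w => hurwitzCont w t) (hurwitzContDeriv t k) (-(k : ℂ)) := by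
  have ht0 : t ≠ 0 := by rintro rfl; simp at ht
  have hk : (k : ℂ) + 1 ≠ 0 := Nat.cast_add_one_ne_zero k
  have h1 : HasDerivAt (fun w => t ^ (1 - w)) (t ^ (1 - -(k : ℂ)) * Complex.log t * -1)
      (-(k : ℂ)) := ((hasDerivAt_id (-(k : ℂ))).const_sub 1).const_cpow (Or.inl ht0)
  have h2 : HasDerivAt (fun w : ℂ => w - 1) 1 (-(k : ℂ)) := (hasDerivAt_id _).sub_const 1
  have h3 := (h1.div h2 (sub_ne_zero.2 (neg_natCast_ne_one k))).sub
    ((hasDerivAt_hermiteInt_cpow_neg ht (-(k : ℂ))).const_mul Complex.I)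
  refine h3.congr_deriv ?_
  have e1 : (1 : ℂ) - -(k : ℂ) = ((k + 1 : ℕ) : ℂ) := by push_cast; ring
  have e2 : -(k : ℂ) - 1 = -((k : ℂ) + 1) := by ring
  have e3 : hermiteInt (fun z => -(z ^ (- -(k : ℂ)) * Complex.log z)) t
      = -hermiteInt (fun z => z ^ k * Complex.log z) t := by
    simp only [hermiteInt, neg_neg, Complex.cpow_natCast]
    rw [← MeasureTheory.integral_neg]
    exact MeasureTheory.integral_congr_ae (.of_forall fun y => by simp only; ring)
  rw [e1, e2, e3, Complex.cpow_natCast, hurwitzContDeriv]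
  field_simp
  ring

theorem differentiableOn_hurwitzContDeriv (k : ℕ) :
    DifferentiableOn ℂ (fun t => hurwitzContDeriv t k) {t | 0 < t.re} := by
  have hlog : DifferentiableOn ℂ Complex.log {t : ℂ | 0 < t.re} := fun z hz =>
    (Complex.differentiableAt_log (Or.inl hz)).differentiableWithinAt
  refine DifferentiableOn.add (DifferentiableOn.mul (by fun_prop) ?_) ?_
  · exact (hlog.div_const _).sub_const _
  · exact (differentiableOn_hermiteInt (differentiableOn_pow_mul_log k)
      (expBounded_pow_mul_log k)).const_mul _

end HurwitzContinuation

/-! ### Barnes zeta functions as sums over layers -/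

section BarnesSeries

theorem natCard_sum_eq (n N : ℕ) :
    Nat.card {m : Fin n → ℕ // ∑ i, m i = N} = (n + N - 1).choose N := by
  rw [← Nat.card_congr (Sym.equivNatSumOfFintype (Fin n) N), Nat.card_eq_fintype_card,
    Sym.card_sym_eq_choose, Fintype.card_fin]

/-- The fibres of m ↦ ∑ mᵢ are finite, of size binom(N+n-1, n-1). The norm is constant on each, so
convergence of the layered series, which is absolute in ℂ, gives summability over all m and permits
the regrouping. -/
theorem tsum_comp_sum {n : ℕ} (hn : 1 ≤ n) {f : ℕ → ℂ} {S : ℂ}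
    (hf : HasSum (fun N => ((N + n - 1).choose (n - 1) : ℂ) * f N) S) :
    ∑' m : Fin n → ℕ, f (∑ i, m i) = S := by
  have hcard : ∀ N : ℕ, Nat.card {m : Fin n → ℕ // ∑ i, m i = N}
      = (N + n - 1).choose (n - 1) := by
    intro N
    rw [natCard_sum_eq, Nat.add_comm n N, ← Nat.choose_symm_of_eq_add]
    omega
  have : ∀ N : ℕ, Finite {m : Fin n → ℕ // ∑ i, m i = N} := fun N =>
    Finite.of_equiv _ (Sym.equivNatSumOfFintype (Fin n) N)
  have hfin : ∀ (N : ℕ) (c : ℂ), ∑' _ : {m : Fin n → ℕ // ∑ i, m i = N}, c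
      = ((N + n - 1).choose (n - 1) : ℂ) * c := by
    intro N c
    rw [tsum_const, hcard, nsmul_eq_mul]
  have hfin' : ∀ (N : ℕ) (c : ℝ), ∑' _ : {m : Fin n → ℕ // ∑ i, m i = N}, c
      = ((N + n - 1).choose (n - 1) : ℝ) * c := by
    intro N c
    rw [tsum_const, hcard, nsmul_eq_mul]
  let e := Equiv.sigmaFiberEquiv fun m : Fin n → ℕ => ∑ i, m i
  rw [← e.tsum_eq]
  have he : ∀ p, (fun m : Fin n → ℕ => f (∑ i, m i)) (e p) = f p.1 := by
    rintro ⟨N, m, rfl⟩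
    rfl
  have hsum : Summable fun p : (Σ N : ℕ, {m : Fin n → ℕ // ∑ i, m i = N}) => f p.1 := by
    rw [← summable_norm_iff]
    refine (summable_sigma_of_nonneg fun p => norm_nonneg _).2 ⟨fun N => ?_, ?_⟩
    · exact Summable.of_finite
    · simp only [hfin']
      refine (summable_norm_iff.2 hf.summable).congr fun N => ?_
      rw [norm_mul, Complex.norm_natCast]
  rw [tsum_congr he, hsum.tsum_sigma]
  simp only [hfin]
  exact hf.tsum_eq

end BarnesSeries

section BarnesPoly
open Polynomial

/-- The polynomial with value `binom(N + n - 1, n - 1)` at `N + z`. -/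
noncomputable def barnesPoly (n : ℕ) (z : ℂ) : ℂ[X] :=
  ((n - 1).factorial : ℂ)⁻¹ • taylor (1 - z) (ascPochhammer ℂ (n - 1))

theorem eval_barnesPoly {n : ℕ} (hn : 1 ≤ n) (z : ℂ) (N : ℕ) :
    (barnesPoly n z).eval ((N : ℂ) + z) = ((N + n - 1).choose (n - 1) : ℂ) := by
  have e : (N : ℂ) + z + (1 - z) = ((N + 1 : ℕ) : ℂ) := by push_cast; ring
  rw [barnesPoly, eval_smul, taylor_eval, e, ascPochhammer_nat_eq_natCast_ascFactorial,
    Nat.ascFactorial_eq_factorial_mul_choose, Nat.add_sub_assoc hn]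
  have : ((n - 1).factorial : ℂ) ≠ 0 := by exact_mod_cast Nat.factorial_ne_zero _
  push_cast
  rw [smul_eq_mul, inv_mul_cancel_left₀ this]

theorem natDegree_barnesPoly_lt {n : ℕ} (hn : 1 ≤ n) (z : ℂ) :
    (barnesPoly n z).natDegree < n := by
  refine (natDegree_smul_le _ _).trans_lt ?_
  rw [natDegree_taylor, ascPochhammer_natDegree]
  omega

theorem differentiable_coeff_barnesPoly (n k : ℕ) :
    Differentiable ℂ fun z => (barnesPoly n z).coeff k := by
  simp only [barnesPoly, coeff_smul, taylor_coeff, smul_eq_mul]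
  refine Differentiable.const_mul ?_ _
  have h : Differentiable ℂ fun z : ℂ => 1 - z := by fun_prop
  exact Differentiable.comp (g := fun x => (hasseDeriv k (ascPochhammer ℂ (n - 1))).eval x)
    (Polynomial.differentiable _) h

end BarnesPoly

/-- The continuation in `w` of `ζ_n(w, z)`, with the first `M` layers split off. -/
noncomputable def barnesCont (n M : ℕ) (z w : ℂ) : ℂ :=
  ∑ N ∈ Finset.range M, ((N + n - 1).choose (n - 1) : ℂ) * ((N : ℂ) + z) ^ (-w) +
    coeffSum (fun k => hurwitzCont (w - k) (z + M - 1 / 2)) (barnesPoly n z)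

/-- The contribution to `log Γ_n(z)` of the layers `N ≥ M`. -/
noncomputable def barnesTail (n M : ℕ) (z : ℂ) : ℂ :=
  coeffSum (hurwitzContDeriv (z + M - 1 / 2)) (barnesPoly n z)

section Barnes

variable {n M : ℕ} {z : ℂ}

theorem tail_re_pos (hM : 1 / 2 - (M : ℝ) < z.re) : 0 < (z + M - 1 / 2).re := by
  simp
  linarith

/-- After M layers the remaining bases are N + 1/2 + t with t = z + M - 1/2 in the right half plane,
where Hermite's formula holds. The polynomial has degree below n, so every shift w - k still has
real part above 1. -/
theorem hasSum_barnesCont (hn : 1 ≤ n) (hM : 1 / 2 - (M : ℝ) < z.re) (hz : ∀ k : ℕ, z ≠ -(k : ℂ))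
    {w : ℂ} (hw : (n : ℝ) < w.re) :
    HasSum (fun N : ℕ => ((N + n - 1).choose (n - 1) : ℂ) * ((N : ℂ) + z) ^ (-w))
      (barnesCont n M z w) := by
  have hne : ∀ N : ℕ, (N : ℂ) + z ≠ 0 := fun N h => hz N (by linear_combination h)
  rw [barnesCont, add_comm, ← hasSum_nat_add_iff]
  have hp := natDegree_barnesPoly_lt hn z
  rw [coeffSum_eq_sum_range _ hp]
  have hk : ∀ k ∈ Finset.range n, HasSum (fun N : ℕ => (barnesPoly n z).coeff k *
      ((N : ℂ) + 1 / 2 + (z + M - 1 / 2)) ^ (-(w - k)))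
      ((barnesPoly n z).coeff k * hurwitzCont (w - k) (z + M - 1 / 2)) := by
    intro k hk
    refine (hasSum_hurwitzCont ?_ (tail_re_pos hM)).mul_left _
    have : (k : ℝ) + 1 ≤ n := by exact_mod_cast Finset.mem_range.1 hk
    simp
    linarith
  refine (hasSum_sum hk).congr_fun fun N => ?_
  have hcast : ((N + M : ℕ) : ℂ) + z = (N : ℂ) + 1 / 2 + (z + M - 1 / 2) := by push_cast; ring
  have h := coeffSum_pow_mul (((N + M : ℕ) : ℂ) + z) ((((N + M : ℕ) : ℂ) + z) ^ (-w))
    (barnesPoly n z)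
  rw [eval_barnesPoly hn, coeffSum_eq_sum_range _ hp] at h
  rw [← h]
  refine Finset.sum_congr rfl fun k _ => ?_
  rw [← hcast, neg_sub, sub_eq_add_neg, Complex.cpow_add _ _ (hne _), Complex.cpow_natCast]

theorem barnesZetaSeries_eq (hn : 1 ≤ n) (hM : 1 / 2 - (M : ℝ) < z.re)
    (hz : ∀ k : ℕ, z ≠ -(k : ℂ)) {w : ℂ} (hw : (n : ℝ) < w.re) :
    barnesZetaSeries n w z = barnesCont n M z w := by
  have h := tsum_comp_sum hn (f := fun N : ℕ => ((N : ℂ) + z) ^ (-w))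
    (hasSum_barnesCont hn hM hz hw)
  rw [← h, barnesZetaSeries]
  push_cast
  rfl

theorem hasContinuedDerivAt_barnesZetaSeries (hn : 1 ≤ n) (hM : 1 / 2 - (M : ℝ) < z.re)
    (hz : ∀ k : ℕ, z ≠ -(k : ℂ)) :
    HasContinuedDerivAt (fun w => barnesZetaSeries n w z) n 0
      (-∑ N ∈ Finset.range M, ((N + n - 1).choose (n - 1) : ℂ) * Complex.log ((N : ℂ) + z) +
        barnesTail n M z) := by
  have hne : ∀ N : ℕ, (N : ℂ) + z ≠ 0 := fun N h => hz N (by linear_combination h)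
  have ht := tail_re_pos hM
  have hd : ∀ w : ℂ, HasDerivAt (fun w : ℂ => ∑ N ∈ Finset.range M,
      ((N + n - 1).choose (n - 1) : ℂ) * ((N : ℂ) + z) ^ (-w))
      (∑ N ∈ Finset.range M, ((N + n - 1).choose (n - 1) : ℂ) *
        (((N : ℂ) + z) ^ (-w) * Complex.log ((N : ℂ) + z) * -1)) w := fun w =>
    HasDerivAt.fun_sum fun N _ =>
      ((hasDerivAt_neg w).const_cpow (Or.inl (hne N))).const_mul _
  have han : ∀ w : ℂ, AnalyticAt ℂ (fun w : ℂ => ∑ N ∈ Finset.range M,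
      ((N + n - 1).choose (n - 1) : ℂ) * ((N : ℂ) + z) ^ (-w)) w :=
    (Differentiable.analyticAt fun w => (hd w).differentiableAt)
  refine ⟨barnesCont n M z, ?_, fun w hw => (barnesZetaSeries_eq hn hM hz hw).symm, ?_, ?_⟩
  · exact fun w => (han w).meromorphicAt.add
      (meromorphic_coeffSum_shift _ (meromorphic_hurwitzCont ht) w)
  · exact (han 0).add (analyticAt_coeffSum_shift (G := fun w => hurwitzCont w (z + M - 1 / 2)) _
      fun k => analyticAt_hurwitzCont ht (neg_natCast_ne_one k))
  · refine ((hd 0).add (hasDerivAt_coeffSum_shift (G := fun w => hurwitzCont w (z + M - 1 / 2)) _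
      fun k => hasDerivAt_hurwitzCont ht k)).deriv.trans ?_
    simp [barnesTail]

theorem logBarnesGamma_eq (hn : 1 ≤ n) (hM : 1 / 2 - (M : ℝ) < z.re)
    (hz : ∀ k : ℕ, z ≠ -(k : ℂ)) :
    logBarnesGamma n z =
      -∑ N ∈ Finset.range M, ((N + n - 1).choose (n - 1) : ℂ) * Complex.log ((N : ℂ) + z) +
        barnesTail n M z :=
  (hasContinuedDerivAt_barnesZetaSeries hn hM hz).continuedDeriv_eq

/-- All singularities of log Γ_n in this half plane therefore sit in the finitely many explicit
logarithms. -/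
theorem differentiableOn_barnesTail (hn : 1 ≤ n) (M : ℕ) :
    DifferentiableOn ℂ (barnesTail n M) {z | 1 / 2 - (M : ℝ) < z.re} := by
  unfold barnesTail
  simp only [coeffSum_eq_sum_range _ (natDegree_barnesPoly_lt hn _)]
  refine DifferentiableOn.fun_sum fun k _ =>
    ((differentiable_coeff_barnesPoly n k).differentiableOn).mul ?_
  exact (differentiableOn_hurwitzContDeriv k).comp (by fun_prop) fun z hz => tail_re_pos hz

theorem exists_tail_index (z : ℂ) : ∃ M : ℕ, 1 / 2 - (M : ℝ) < z.re := by
  obtain ⟨M, hM⟩ := exists_nat_gt (1 / 2 - z.re)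
  exact ⟨M, by linarith⟩

end Barnes

/-! ### Continuation of J_1 -/

section MomentBase

theorem re_add_mul_I_pos {t : ℂ} (ht : 0 < t.re) (x : ℝ) : 0 < (t + x * Complex.I).re := by
  simpa using ht

theorem re_sub_mul_I_pos {t : ℂ} (ht : 0 < t.re) (x : ℝ) : 0 < (t - x * Complex.I).re := by
  simpa using ht

theorem ne_zero_of_re_pos {z : ℂ} (hz : 0 < z.re) : z ≠ 0 := by
  rintro rfl
  simp at hz

/-- Both arguments lie in (-π/2, π/2), so their sum stays in the principal range. Applied to x²+t² =
(t+ix)(t-ix), it produces the same logarithms as in Hermite's formula. -/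
theorem log_mul_of_re_pos {a b : ℂ} (ha : 0 < a.re) (hb : 0 < b.re) :
    Complex.log (a * b) = Complex.log a + Complex.log b := by
  have h1 := abs_lt.1 (Complex.abs_arg_lt_pi_div_two_iff.2 (Or.inl ha))
  have h2 := abs_lt.1 (Complex.abs_arg_lt_pi_div_two_iff.2 (Or.inl hb))
  exact Complex.log_mul (ne_zero_of_re_pos ha) (ne_zero_of_re_pos hb)
    ⟨by linarith [h1.1, h2.1], by linarith [h1.2, h2.2]⟩

theorem mul_cpow_of_re_pos {a b : ℂ} (ha : 0 < a.re) (hb : 0 < b.re) (c : ℂ) :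
    (a * b) ^ c = a ^ c * b ^ c := by
  have ha0 := ne_zero_of_re_pos ha
  have hb0 := ne_zero_of_re_pos hb
  rw [Complex.cpow_def_of_ne_zero (mul_ne_zero ha0 hb0), Complex.cpow_def_of_ne_zero ha0,
    Complex.cpow_def_of_ne_zero hb0, log_mul_of_re_pos ha hb, add_mul, Complex.exp_add]

theorem sq_add_sq_eq_mul (x : ℝ) (t : ℂ) :
    (x : ℂ) ^ 2 + t ^ 2 = (t + x * Complex.I) * (t - x * Complex.I) := by
  linear_combination (x : ℂ) ^ 2 * Complex.I_sq

theorem sq_add_sq_mem_slitPlane {t : ℂ} (ht : 0 < t.re) (x : ℝ) :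
    (x : ℂ) ^ 2 + t ^ 2 ∈ Complex.slitPlane := by
  by_cases h : t.im = 0
  · left
    have : 0 < t.re * t.re := mul_pos ht ht
    simp [pow_two, h]
    nlinarith [mul_self_nonneg x]
  · right
    have h2 : t.re * t.im + t.im * t.re = 2 * (t.re * t.im) := by ring
    simp [pow_two, h2, ht.ne', h]

theorem exists_norm_sq_add_sq_cpow_le (t : ℂ) {a : ℂ} (ha : a.re < 0) :
    ∃ C : ℝ, ∀ᶠ x : ℝ in Filter.atTop, ‖((x : ℂ) ^ 2 + t ^ 2) ^ a‖ ≤ C * x ^ (2 * a.re) := by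
  refine ⟨Real.exp (Real.pi * |a.im|) * 2 ^ (-a.re), ?_⟩
  filter_upwards [Filter.eventually_ge_atTop (2 * ‖t‖ + 1)] with x hx
  have htn := norm_nonneg t
  have hx0 : 0 < x := by linarith
  -- For x ≥ 2‖t‖ one has ‖t‖² ≤ x²/4, so x² - ‖t‖² ≥ x²/2.
  have hlow : x ^ 2 / 2 ≤ ‖(x : ℂ) ^ 2 + t ^ 2‖ := by
    have h := norm_sub_le ((x : ℂ) ^ 2 + t ^ 2) (t ^ 2)
    rw [add_sub_cancel_right, norm_pow, norm_pow, Complex.norm_real,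
      Real.norm_of_nonneg hx0.le] at h
    nlinarith
  have hpos : 0 < x ^ 2 / 2 := by positivity
  have hne : (x : ℂ) ^ 2 + t ^ 2 ≠ 0 := norm_pos_iff.1 (hpos.trans_le hlow)
  rw [Complex.norm_cpow_of_ne_zero hne]
  have h1 : ‖(x : ℂ) ^ 2 + t ^ 2‖ ^ a.re ≤ 2 ^ (-a.re) * x ^ (2 * a.re) := by
    calc ‖(x : ℂ) ^ 2 + t ^ 2‖ ^ a.re ≤ (x ^ 2 / 2) ^ a.re :=
          Real.rpow_le_rpow_of_nonpos hpos hlow ha.le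
      _ = _ := by
        rw [Real.div_rpow (by positivity) (by norm_num), Real.rpow_neg (by norm_num),
          Real.rpow_mul hx0.le, Real.rpow_two]
        ring
  have h2 : (Real.exp (Complex.arg ((x : ℂ) ^ 2 + t ^ 2) * a.im))⁻¹
      ≤ Real.exp (Real.pi * |a.im|) := by
    rw [← Real.exp_neg, Real.exp_le_exp]
    have h3 := neg_abs_le (Complex.arg ((x : ℂ) ^ 2 + t ^ 2) * a.im)
    rw [abs_mul] at h3
    have h4 := mul_le_mul_of_nonneg_right (Complex.abs_arg_le_pi ((x : ℂ) ^ 2 + t ^ 2))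
      (abs_nonneg a.im)
    linarith
  rw [div_eq_mul_inv]
  calc _ ≤ 2 ^ (-a.re) * x ^ (2 * a.re) * Real.exp (Real.pi * |a.im|) := by gcongr
    _ = _ := by ring

variable {t : ℂ}
open MeasureTheory

theorem continuous_sq_add_sq_cpow (ht : 0 < t.re) (a : ℂ) :
    Continuous fun x : ℝ => ((x : ℂ) ^ 2 + t ^ 2) ^ a := by
  refine continuous_iff_continuousAt.2 fun x => ?_
  exact ContinuousAt.cpow (by fun_prop) continuousAt_const (sq_add_sq_mem_slitPlane ht x)

theorem integrableOn_mul_sq_add_sq_cpow (ht : 0 < t.re) {v : ℂ} (hv : 1 < v.re) :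
    IntegrableOn (fun x : ℝ => ((x : ℂ) ^ 2 + t ^ 2) ^ (-v) * x) (Set.Ioi 0) := by
  have hc : Continuous fun x : ℝ => ((x : ℂ) ^ 2 + t ^ 2) ^ (-v) * (x : ℂ) :=
    (continuous_sq_add_sq_cpow ht _).mul Complex.continuous_ofReal
  obtain ⟨C, hC⟩ := exists_norm_sq_add_sq_cpow_le t (a := -v) (by simp; linarith)
  have hO : (fun x : ℝ => ((x : ℂ) ^ 2 + t ^ 2) ^ (-v) * (x : ℂ)) =O[Filter.atTop]
      fun x : ℝ => x ^ (1 - 2 * v.re) := by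
    refine Asymptotics.IsBigO.of_bound C ?_
    filter_upwards [hC, Filter.eventually_gt_atTop 0] with x hx hx0
    rw [norm_mul, Complex.norm_real, Real.norm_of_nonneg hx0.le,
      Real.norm_of_nonneg (by positivity)]
    calc _ ≤ C * x ^ (2 * (-v).re) * x := by gcongr
      _ = C * x ^ (1 - 2 * v.re) := by
        rw [mul_assoc, ← Real.rpow_add_one hx0.ne']
        congr 2
        simp; ring
  have h := (hc.locallyIntegrable.locallyIntegrableOn (Set.Ici 0)).integrableOn_of_isBigO_atTop hO
    ⟨Set.Ioi 1, Filter.Ioi_mem_atTop 1, integrableOn_Ioi_rpow_of_lt (by linarith) one_pos⟩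
  exact h.mono_set Set.Ioi_subset_Ici_self

theorem integral_mul_sq_add_sq_cpow (ht : 0 < t.re) {v : ℂ} (hv : 1 < v.re) :
    ∫ x in Set.Ioi (0 : ℝ), ((x : ℂ) ^ 2 + t ^ 2) ^ (-v) * x
      = (t ^ 2) ^ (1 - v) / (2 * (v - 1)) := by
  have hv1 : v - 1 ≠ 0 := by
    intro h
    have : v.re - 1 = 0 := by simpa using congrArg Complex.re h
    linarith
  have hv2 : 1 - v ≠ 0 := by rw [← neg_sub]; exact neg_ne_zero.2 hv1
  have hder : ∀ x : ℝ, HasDerivAt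
      (fun x : ℝ => ((x : ℂ) ^ 2 + t ^ 2) ^ (1 - v) / (2 * (1 - v)))
      (((x : ℂ) ^ 2 + t ^ 2) ^ (-v) * x) x := by
    intro x
    have h1 : HasDerivAt (fun z : ℂ => z ^ 2 + t ^ 2) (2 * x) (x : ℂ) := by
      simpa using (hasDerivAt_pow 2 (x : ℂ)).add_const (t ^ 2)
    have h2 := HasDerivAt.cpow_const (c := 1 - v) h1 (sq_add_sq_mem_slitPlane ht x)
    refine (h2.div_const (2 * (1 - v))).comp_ofReal.congr_deriv ?_
    have e : 1 - v - 1 = -v := by ring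
    rw [e]
    field_simp
  have hlim : Filter.Tendsto (fun x : ℝ => ((x : ℂ) ^ 2 + t ^ 2) ^ (1 - v) / (2 * (1 - v)))
      Filter.atTop (𝓝 0) := by
    have hre : (1 - v).re < 0 := by simp; linarith
    obtain ⟨C, hC⟩ := exists_norm_sq_add_sq_cpow_le t hre
    have h0 : Filter.Tendsto (fun x : ℝ => C * x ^ (2 * (1 - v).re)) Filter.atTop (𝓝 0) := by
      have := (tendsto_rpow_neg_atTop (y := -(2 * (1 - v).re)) (by linarith)).const_mul C
      simpa using this
    have := (squeeze_zero_norm' hC h0).div_const (2 * (1 - v))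
    simpa using this
  rw [integral_Ioi_of_hasDerivAt_of_tendsto (hder 0).continuousAt.continuousWithinAt
    (fun x _ => hder x) (integrableOn_mul_sq_add_sq_cpow ht hv) hlim]
  simp
  field_simp
  ring

theorem norm_moment_integrand_le {C x : ℝ} (hC : 0 ≤ C) (hx : 0 < x) {a b : ℂ}
    (ha : ‖a‖ ≤ C * Real.exp ‖t + x * Complex.I‖) (hb : ‖b‖ ≤ C * Real.exp ‖t - x * Complex.I‖) :
    ‖a * b * (x * fermiWeight x : ℂ)‖ ≤ C ^ 2 * Real.exp (2 * ‖t‖) * Real.exp (-x) := by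
  have h1 : ‖t + x * Complex.I‖ ≤ ‖t‖ + x := by
    refine (norm_add_le _ _).trans ?_
    simp [abs_of_pos hx]
  have h2 : ‖t - x * Complex.I‖ ≤ ‖t‖ + x := by
    refine (norm_sub_le _ _).trans ?_
    simp [abs_of_pos hx]
  have hxe : x ≤ Real.exp x := by linarith [Real.add_one_le_exp x]
  rw [norm_mul, norm_mul, norm_mul, Complex.norm_real, Complex.norm_real,
    Real.norm_of_nonneg (fermiWeight_pos x).le, Real.norm_of_nonneg hx.le]
  calc ‖a‖ * ‖b‖ * (x * fermiWeight x)
      ≤ (C * Real.exp (‖t‖ + x)) * (C * Real.exp (‖t‖ + x)) *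
        (Real.exp x * Real.exp (-(6 * x))) := by
        have ha' : ‖a‖ ≤ C * Real.exp (‖t‖ + x) := ha.trans (by gcongr)
        have hb' : ‖b‖ ≤ C * Real.exp (‖t‖ + x) := hb.trans (by gcongr)
        have := fermiWeight_le hx.le
        have := (fermiWeight_pos x).le
        gcongr
    _ = C ^ 2 * (Real.exp (‖t‖ + x) * Real.exp (‖t‖ + x) * Real.exp x * Real.exp (-(6 * x))) := by
      ring
    _ = C ^ 2 * (Real.exp (2 * ‖t‖) * Real.exp (-(3 * x))) := by
      simp only [← Real.exp_add]
      congr 2; ring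
    _ ≤ C ^ 2 * (Real.exp (2 * ‖t‖) * Real.exp (-x)) := by
      gcongr; linarith
    _ = _ := by ring

/-- The exponentially small part of `J_1(v, t)`. -/
noncomputable def momentInt (v t : ℂ) : ℂ :=
  ∫ x in Set.Ioi (0 : ℝ), (t + x * Complex.I) ^ (-v) * (t - x * Complex.I) ^ (-v) *
    (x * fermiWeight x : ℂ)

theorem continuous_moment_integrand (ht : 0 < t.re) (v : ℂ) : Continuous fun x : ℝ =>
    (t + x * Complex.I) ^ (-v) * (t - x * Complex.I) ^ (-v) * (x * fermiWeight x : ℂ) := by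
  have h1 : Continuous fun x : ℝ => (t + x * Complex.I) ^ (-v) :=
    (differentiableOn_cpow_neg v).continuousOn.comp_continuous (by fun_prop)
      fun x => re_add_mul_I_pos ht x
  have h2 : Continuous fun x : ℝ => (t - x * Complex.I) ^ (-v) :=
    (differentiableOn_cpow_neg v).continuousOn.comp_continuous (by fun_prop)
      fun x => re_sub_mul_I_pos ht x
  exact (h1.mul h2).mul (Complex.continuous_ofReal.mul
    (Complex.continuous_ofReal.comp continuous_fermiWeight))

theorem integrableOn_moment_integrand (ht : 0 < t.re) (v : ℂ) : IntegrableOn (fun x : ℝ =>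
    (t + x * Complex.I) ^ (-v) * (t - x * Complex.I) ^ (-v) * (x * fermiWeight x : ℂ))
    (Set.Ioi 0) := by
  obtain ⟨C, hC, hCb⟩ := expBounded_cpow_neg v t.re ht
  refine Integrable.mono' ((integrableOn_exp_neg_Ioi 0).const_mul (C ^ 2 * Real.exp (2 * ‖t‖)))
    (continuous_moment_integrand ht v).aestronglyMeasurable ?_
  refine (ae_restrict_iff' measurableSet_Ioi).2 (.of_forall fun x hx => ?_)
  exact norm_moment_integrand_le hC hx (hCb _ (by simp)) (hCb _ (by simp))

theorem hasDerivAt_momentInt (ht : 0 < t.re) (v₀ : ℂ) :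
    HasDerivAt (fun v => momentInt v t) (∫ x in Set.Ioi (0 : ℝ),
      -(Complex.log (t + x * Complex.I) + Complex.log (t - x * Complex.I)) *
      ((t + x * Complex.I) ^ (-v₀) * (t - x * Complex.I) ^ (-v₀) * (x * fermiWeight x : ℂ))) v₀ := by
  obtain ⟨n, hn⟩ := exists_nat_ge (‖v₀‖ + 1)
  obtain ⟨C, hC, hCb⟩ := exists_norm_cpow_neg_le n ht
  refine hasDerivAt_integral_of_dominated_holomorphic one_pos
    (F' := fun v (x : ℝ) => -(Complex.log (t + x * Complex.I) + Complex.log (t - x * Complex.I)) *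
      ((t + x * Complex.I) ^ (-v) * (t - x * Complex.I) ^ (-v) * (x * fermiWeight x : ℂ)))
    (g := fun x : ℝ => C ^ 2 * Real.exp (2 * ‖t‖) * Real.exp (-x))
    ((integrableOn_exp_neg_Ioi 0).const_mul _) ?_ ?_ ?_ ?_
  · intro v _
    exact (continuous_moment_integrand ht v).aestronglyMeasurable
  · have h1 : Continuous fun x : ℝ => Complex.log (t + x * Complex.I) :=
      Continuous.clog (by fun_prop) fun x => Or.inl (re_add_mul_I_pos ht x)
    have h2 : Continuous fun x : ℝ => Complex.log (t - x * Complex.I) :=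
      Continuous.clog (by fun_prop) fun x => Or.inl (re_sub_mul_I_pos ht x)
    exact ((h1.add h2).neg.mul (continuous_moment_integrand ht v₀)).aestronglyMeasurable
  · refine .of_forall fun x v _ => ?_
    have h1 := (hasDerivAt_neg v).const_cpow (c := t + x * Complex.I)
      (Or.inl (ne_zero_of_re_pos (re_add_mul_I_pos ht x)))
    have h2 := (hasDerivAt_neg v).const_cpow (c := t - x * Complex.I)
      (Or.inl (ne_zero_of_re_pos (re_sub_mul_I_pos ht x)))
    refine ((h1.mul h2).mul_const _).congr_deriv ?_
    ring
  · refine (ae_restrict_iff' measurableSet_Ioi).2 (.of_forall fun x hx v hv => ?_)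
    have hvn : ‖v‖ ≤ n := by
      have := norm_sub_norm_le v v₀
      have := (mem_ball_iff_norm.1 hv).le
      linarith
    refine norm_moment_integrand_le hC hx (hCb v hvn _ ?_) (hCb v hvn _ ?_)
    · simpa using Complex.re_le_norm (t + x * Complex.I)
    · simpa using Complex.re_le_norm (t - x * Complex.I)

/-- The continuation in `v` of `J_1(v, t)`, `Re t > 0`. -/
noncomputable def momentCont (v t : ℂ) : ℂ :=
  (t ^ 2) ^ (1 - v) / (2 * (v - 1)) - 2 * momentInt v t

/-- The derivative of `momentCont · t` at `-k`. -/
noncomputable def momentContDeriv (t : ℂ) (k : ℕ) : ℂ :=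
  t ^ (2 * (k + 1)) * (Complex.log t / (k + 1) - 1 / (2 * ((k : ℂ) + 1) ^ 2)) +
    2 * ∫ x in Set.Ioi (0 : ℝ), (Complex.log (t + x * Complex.I) +
      Complex.log (t - x * Complex.I)) * (((x : ℂ) ^ 2 + t ^ 2) ^ k * (x * fermiWeight x : ℂ))

theorem tanh_pi_mul_eq (x : ℝ) : Real.tanh (Real.pi * x) = 1 - 2 * fermiWeight x := by
  have h1 : Real.exp (2 * Real.pi * x) = Real.exp (Real.pi * x) ^ 2 := by
    rw [← Real.exp_nat_mul]; congr 1; push_cast; ring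
  have h2 := Real.exp_pos (Real.pi * x)
  rw [Real.tanh_eq_sinh_div_cosh, Real.sinh_eq, Real.cosh_eq, fermiWeight, h1, Real.exp_neg]
  field_simp
  ring

/-- The constant 1 in tanh(πx) = 1 - 2/(e^{2πx}+1) gives an exact derivative, hence the only pole;
the rest decays exponentially for every v. -/
theorem integral_tanh_eq_momentCont (ht : 0 < t.re) {v : ℂ} (hv : 1 < v.re) :
    IntegrableOn (fun x : ℝ => ((x : ℂ) ^ 2 + t ^ 2) ^ (-v) * x *
      (Real.tanh (Real.pi * x) : ℂ)) (Set.Ioi 0) ∧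
    ∫ x in Set.Ioi (0 : ℝ), ((x : ℂ) ^ 2 + t ^ 2) ^ (-v) * x *
      (Real.tanh (Real.pi * x) : ℂ) = momentCont v t := by
  have e : ∀ x : ℝ, ((x : ℂ) ^ 2 + t ^ 2) ^ (-v) * x * (Real.tanh (Real.pi * x) : ℂ)
      = ((x : ℂ) ^ 2 + t ^ 2) ^ (-v) * x - 2 * ((t + x * Complex.I) ^ (-v) *
        (t - x * Complex.I) ^ (-v) * (x * fermiWeight x : ℂ)) := by
    intro x
    rw [tanh_pi_mul_eq, ← mul_cpow_of_re_pos (re_add_mul_I_pos ht x) (re_sub_mul_I_pos ht x),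
      ← sq_add_sq_eq_mul]
    push_cast
    ring
  simp only [e]
  have h1 := integrableOn_mul_sq_add_sq_cpow ht hv
  have h2 := (integrableOn_moment_integrand ht v).const_mul 2
  refine ⟨h1.sub h2, ?_⟩
  rw [integral_sub h1 h2, integral_mul_sq_add_sq_cpow ht hv, integral_const_mul]
  rfl

theorem sq_ne_zero_of_re_pos (ht : 0 < t.re) : t ^ 2 ≠ 0 := pow_ne_zero 2 (ne_zero_of_re_pos ht)

theorem meromorphic_momentCont (ht : 0 < t.re) : Meromorphic fun v => momentCont v t := by
  intro x
  have h1 : AnalyticAt ℂ (fun w => (t ^ 2) ^ (1 - w)) x := by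
    simpa [sub_eq_add_neg] using analyticAt_cpow_linear (sq_ne_zero_of_re_pos ht) 1 (-1) x
  have h2 : AnalyticAt ℂ (fun w : ℂ => 2 * (w - 1)) x := by fun_prop
  have h3 : Differentiable ℂ fun v => momentInt v t := fun v =>
    (hasDerivAt_momentInt ht v).differentiableAt
  exact (h1.meromorphicAt.div h2.meromorphicAt).sub
    (analyticAt_const.mul (h3.analyticAt x)).meromorphicAt

theorem analyticAt_momentCont (ht : 0 < t.re) {x : ℂ} (hx : x ≠ 1) :
    AnalyticAt ℂ (fun v => momentCont v t) x := by
  have h1 : AnalyticAt ℂ (fun w => (t ^ 2) ^ (1 - w)) x := by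
    simpa [sub_eq_add_neg] using analyticAt_cpow_linear (sq_ne_zero_of_re_pos ht) 1 (-1) x
  have h2 : AnalyticAt ℂ (fun w : ℂ => 2 * (w - 1)) x := by fun_prop
  have h3 : Differentiable ℂ fun v => momentInt v t := fun v =>
    (hasDerivAt_momentInt ht v).differentiableAt
  exact (h1.div h2 (mul_ne_zero two_ne_zero (sub_ne_zero.2 hx))).sub
    (analyticAt_const.mul (h3.analyticAt x))

theorem hasDerivAt_momentCont (ht : 0 < t.re) (k : ℕ) :
    HasDerivAt (fun v => momentCont v t) (momentContDeriv t k) (-(k : ℂ)) := by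
  have hk : (k : ℂ) + 1 ≠ 0 := Nat.cast_add_one_ne_zero k
  have h1 : HasDerivAt (fun w => (t ^ 2) ^ (1 - w))
      ((t ^ 2) ^ (1 - -(k : ℂ)) * Complex.log (t ^ 2) * -1) (-(k : ℂ)) :=
    ((hasDerivAt_id (-(k : ℂ))).const_sub 1).const_cpow (Or.inl (sq_ne_zero_of_re_pos ht))
  have h2 : HasDerivAt (fun w : ℂ => 2 * (w - 1)) (2 * 1) (-(k : ℂ)) :=
    ((hasDerivAt_id _).sub_const 1).const_mul 2
  have h3 := (h1.div h2 (mul_ne_zero two_ne_zero (sub_ne_zero.2 (neg_natCast_ne_one k)))).sub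
    ((hasDerivAt_momentInt ht (-(k : ℂ))).const_mul 2)
  refine h3.congr_deriv ?_
  have e1 : (1 : ℂ) - -(k : ℂ) = ((k + 1 : ℕ) : ℂ) := by push_cast; ring
  have e2 : -(k : ℂ) - 1 = -((k : ℂ) + 1) := by ring
  have e3 : ∀ x : ℝ, -(Complex.log (t + x * Complex.I) + Complex.log (t - x * Complex.I)) *
      ((t + x * Complex.I) ^ (- -(k : ℂ)) * (t - x * Complex.I) ^ (- -(k : ℂ)) *
        (x * fermiWeight x : ℂ))
      = -((Complex.log (t + x * Complex.I) + Complex.log (t - x * Complex.I)) *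
        (((x : ℂ) ^ 2 + t ^ 2) ^ k * (x * fermiWeight x : ℂ))) := by
    intro x
    rw [neg_neg, Complex.cpow_natCast, Complex.cpow_natCast, ← mul_pow, ← sq_add_sq_eq_mul]
    ring
  have e4 : Complex.log (t ^ 2) = 2 * Complex.log t := by
    rw [pow_two, log_mul_of_re_pos ht ht]; ring
  simp only [e3]
  rw [integral_neg, e1, e2, e4, Complex.cpow_natCast, momentContDeriv, ← pow_mul]
  generalize (∫ x in Set.Ioi (0 : ℝ), (Complex.log (t + x * Complex.I) +
    Complex.log (t - x * Complex.I)) * (((x : ℂ) ^ 2 + t ^ 2) ^ k * (x * fermiWeight x : ℂ))) = A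
  field_simp
  ring

end MomentBase

/-! ### Higher moments reduced to J_1 -/

section Moments
open MeasureTheory Polynomial

variable {t : ℂ}

/-- The factor x^{2l} is ((x²+t²) - t²)^l, and each power of x²+t² shifts w by one. -/
theorem momentIntegral_eq (ht : 0 < t.re) (l : ℕ) {w : ℂ} (hw : (l : ℝ) + 1 < w.re) :
    momentIntegral (2 * l + 1) w t =
      coeffSum (fun k => momentCont (w - k) t) ((X - C (t ^ 2)) ^ l) := by
  have hp : ((X - C (t ^ 2)) ^ l).natDegree < l + 1 := by
    rw [natDegree_pow, natDegree_X_sub_C]; omega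
  have hk : ∀ k ∈ Finset.range (l + 1), 1 < (w - k).re := by
    intro k hk
    have : (k : ℝ) ≤ l := by exact_mod_cast Nat.lt_succ_iff.1 (Finset.mem_range.1 hk)
    simp
    linarith
  rw [coeffSum_eq_sum_range _ hp, momentIntegral]
  have e : ∀ x : ℝ, ((x : ℂ) ^ 2 + t ^ 2) ^ (-w) * (x : ℂ) ^ (2 * l + 1) *
      (Real.tanh (Real.pi * x) : ℂ) = ∑ k ∈ Finset.range (l + 1),
        ((X - C (t ^ 2)) ^ l).coeff k * (((x : ℂ) ^ 2 + t ^ 2) ^ (-(w - k)) * x *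
          (Real.tanh (Real.pi * x) : ℂ)) := by
    intro x
    have hne : (x : ℂ) ^ 2 + t ^ 2 ≠ 0 :=
      Complex.slitPlane_ne_zero (sq_add_sq_mem_slitPlane ht x)
    have h := coeffSum_pow_mul ((x : ℂ) ^ 2 + t ^ 2) (((x : ℂ) ^ 2 + t ^ 2) ^ (-w) * x *
          (Real.tanh (Real.pi * x) : ℂ)) ((X - C (t ^ 2)) ^ l)
    rw [coeffSum_eq_sum_range _ hp] at h
    have hx : ∀ k : ℕ, ((x : ℂ) ^ 2 + t ^ 2) ^ (-(w - k)) =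
        ((x : ℂ) ^ 2 + t ^ 2) ^ k * ((x : ℂ) ^ 2 + t ^ 2) ^ (-w) := by
      intro k
      rw [neg_sub, sub_eq_add_neg, Complex.cpow_add _ _ hne, Complex.cpow_natCast]
    simp only [hx]
    simp only [← mul_assoc] at h ⊢
    rw [h, eval_pow, eval_sub, eval_X, eval_C]
    ring
  simp only [e]
  rw [integral_finsetSum _ fun k hk' =>
    (integral_tanh_eq_momentCont ht (hk k hk')).1.const_mul _]
  refine Finset.sum_congr rfl fun k hk' => ?_
  rw [integral_const_mul, (integral_tanh_eq_momentCont ht (hk k hk')).2]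

theorem hasContinuedDerivAt_momentIntegral (ht : 0 < t.re) (l : ℕ) :
    HasContinuedDerivAt (fun w => momentIntegral (2 * l + 1) w t) ((l : ℝ) + 1) 0
      (coeffSum (momentContDeriv t) ((X - C (t ^ 2)) ^ l)) :=
  ⟨fun w => coeffSum (fun k => momentCont (w - k) t) ((X - C (t ^ 2)) ^ l),
    meromorphic_coeffSum_shift (G := fun v => momentCont v t) _ (meromorphic_momentCont ht),
    fun _ hw => (momentIntegral_eq ht l hw).symm,
    analyticAt_coeffSum_shift (G := fun v => momentCont v t) _
      fun k => analyticAt_momentCont ht (neg_natCast_ne_one k),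
    (hasDerivAt_coeffSum_shift (G := fun v => momentCont v t) _
      fun k => hasDerivAt_momentCont ht k).deriv⟩

theorem momentDeriv_eq (ht : 0 < t.re) (l : ℕ) :
    momentDeriv l t = coeffSum (momentContDeriv t) ((X - C (t ^ 2)) ^ l) :=
  (hasContinuedDerivAt_momentIntegral ht l).continuedDeriv_eq

/-- By linearity this is X^r = ((X - t²) + t²)^r expanded binomially. -/
theorem sum_choose_mul_momentDeriv (ht : 0 < t.re) (r : ℕ) :
    ∑ l ∈ Finset.range (r + 1), (r.choose l : ℂ) * t ^ (2 * (r - l)) * momentDeriv l t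
      = momentContDeriv t r := by
  simp only [momentDeriv_eq ht]
  have hX : (X : ℂ[X]) ^ r = ∑ l ∈ Finset.range (r + 1),
      ((r.choose l : ℂ) * t ^ (2 * (r - l))) • (X - C (t ^ 2)) ^ l := by
    have := add_pow (X - C (t ^ 2)) (C (t ^ 2)) r
    rw [sub_add_cancel] at this
    rw [this]
    refine Finset.sum_congr rfl fun l _ => ?_
    rw [← C_mul', ← C_pow, ← pow_mul, C_mul, C_eq_natCast]
    ring
  have h : coeffSum (momentContDeriv t) (X ^ r) = momentContDeriv t r := by
    rw [coeffSum_eq_sum_range _ (by rw [natDegree_X_pow]; exact Nat.lt_succ_self r)]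
    simp [coeff_X_pow]
  rw [← h, hX, map_sum]
  simp only [map_smul, smul_eq_mul]

end Moments

theorem sum_Icc_one_eq_sum_range (f : ℕ → ℂ) (n : ℕ) :
    ∑ j ∈ Finset.Icc 1 n, f j = ∑ k ∈ Finset.range n, f (k + 1) := by
  induction n with
  | zero => simp
  | succ n ih => rw [Finset.sum_Icc_succ_top (by omega), ih, Finset.sum_range_succ]

/-! ### Newton series and the coefficients c_{p,j} -/

section Newton
open Polynomial

/-- Both polynomials agree at every natural number m: differences of order ≥ n vanish, and
binom(m,k) vanishes for k > m. -/
theorem newton_series {p : ℂ[X]} {n : ℕ} (hp : p.natDegree < n) :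
    p = ∑ k ∈ Finset.range n,
      ((k.factorial : ℂ)⁻¹ * (fwdDiff 1)^[k] p.eval 0) • descPochhammer ℂ k := by
  refine eq_of_infinite_eval_eq _ _ ?_
  refine (Set.infinite_range_of_injective (Nat.cast_injective (R := ℂ))).mono ?_
  rintro _ ⟨m, rfl⟩
  have h := shift_eq_sum_fwdDiff_iter (1 : ℂ) p.eval m 0
  rw [zero_add, nsmul_one] at h
  have h1 : ∑ k ∈ Finset.range (m + 1), m.choose k • (fwdDiff 1)^[k] p.eval (0 : ℂ)
      = ∑ k ∈ Finset.range (m + 1 + n), m.choose k • (fwdDiff 1)^[k] p.eval (0 : ℂ) := by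
    refine Finset.sum_subset (by simp) fun k _ hk => ?_
    rw [Nat.choose_eq_zero_of_lt (by simpa using hk), zero_smul]
  have h2 : ∑ k ∈ Finset.range n, m.choose k • (fwdDiff 1)^[k] p.eval (0 : ℂ)
      = ∑ k ∈ Finset.range (m + 1 + n), m.choose k • (fwdDiff 1)^[k] p.eval (0 : ℂ) := by
    refine Finset.sum_subset (by simp) fun k _ hk => ?_
    rw [fwdDiff_iter_eq_zero_of_degree_lt (hp.trans_le (by simpa using hk))]
    simp
  show p.eval (m : ℂ) = eval (m : ℂ) _
  rw [h, h1, ← h2, eval_finsetSum]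
  refine Finset.sum_congr rfl fun k _ => ?_
  rw [eval_smul, descPochhammer_eval_eq_descFactorial, Nat.descFactorial_eq_factorial_mul_choose]
  have : (k.factorial : ℂ) ≠ 0 := by exact_mod_cast k.factorial_ne_zero
  push_cast
  rw [nsmul_eq_mul, smul_eq_mul]
  field_simp

theorem fwdDiff_iter_eq_cCoeff (p k : ℕ) (z : ℂ) :
    (fwdDiff 1)^[k] ((C (z - 1) - X) ^ (p - 1) : ℂ[X]).eval 0 = (-1) ^ k * cCoeff p (k + 1) z := by
  rw [fwdDiff_iter_eq_sum_shift, cCoeff, Finset.mul_sum]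
  refine Finset.sum_congr rfl fun l hl => ?_
  have hl : l ≤ k := Nat.lt_succ_iff.1 (Finset.mem_range.1 hl)
  obtain ⟨m, rfl⟩ := Nat.exists_eq_add_of_le hl
  have hs : ((-1 : ℂ) ^ l) * (-1) ^ l = 1 := by rw [← mul_pow]; simp
  simp only [zero_add, nsmul_one, eval_pow, eval_sub, eval_C, eval_X, zsmul_eq_mul,
    Nat.add_sub_cancel_left, Nat.add_sub_cancel, pow_add]
  push_cast
  have e : z - l - 1 = z - 1 - l := by ring
  rw [e]
  linear_combination (-(-1 : ℂ) ^ m * ((l + m).choose l : ℂ) * (z - 1 - l) ^ (p - 1)) * hs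

/-- Up to sign, the c_{p,j}(z) are the forward differences at 0 of (z-1-X)^{p-1}. Evaluating its
Newton series at -(y+1) turns descending factorials into ascending ones and cancels the signs. -/
theorem sum_cCoeff_mul_ascPochhammer {p : ℕ} (hp : 1 ≤ p) (z y : ℂ) :
    ∑ j ∈ Finset.Icc 1 p, cCoeff p j z *
      (((j - 1).factorial : ℂ)⁻¹ * (ascPochhammer ℂ (j - 1)).eval (y + 1)) = (y + z) ^ (p - 1) := by
  have hdeg : ((C (z - 1) - X) ^ (p - 1) : ℂ[X]).natDegree < p := by
    refine (natDegree_pow_le_of_le (p - 1) (m := 1) ?_).trans_lt (by omega)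
    exact (natDegree_sub_le _ _).trans (by rw [natDegree_C, natDegree_X]; simp)
  have h := congrArg (eval (-(y + 1))) (newton_series hdeg)
  have e : z - 1 - -(y + 1) = y + z := by ring
  have hl : eval (-(y + 1)) ((C (z - 1) - X) ^ (p - 1) : ℂ[X]) = (y + z) ^ (p - 1) := by
    rw [eval_pow, eval_sub, eval_C, eval_X, e]
  rw [hl, eval_finsetSum] at h
  rw [h, sum_Icc_one_eq_sum_range]
  refine Finset.sum_congr rfl fun k _ => ?_
  have ha := ascPochhammer_eval_neg_eq_descPochhammer (R := ℂ) (-(y + 1)) k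
  rw [neg_neg] at ha
  have hs : ((-1 : ℂ) ^ k) * (-1) ^ k = 1 := by rw [← mul_pow]; simp
  rw [fwdDiff_iter_eq_cCoeff, eval_smul, smul_eq_mul, Nat.add_sub_cancel, ha]
  ring

end Newton

/-! ### The polynomial identity for the exponents -/

section AlphaPoly
open Polynomial

theorem eval_barnesPoly_add (n : ℕ) (y z : ℂ) : (barnesPoly n z).eval (y + z)
    = ((n - 1).factorial : ℂ)⁻¹ * (ascPochhammer ℂ (n - 1)).eval (y + 1) := by
  have e : y + z + (1 - z) = y + 1 := by ring
  rw [barnesPoly, eval_smul, taylor_eval, e, smul_eq_mul]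

theorem eval_alphaPoly (r j : ℕ) (t : ℂ) : (alphaPoly r j).eval t =
    4 * ∑ l ∈ Finset.Icc ((j + 1) / 2) r,
      ((r - 1).choose (l - 1) : ℂ) * (-1) ^ (l - 1) * cCoeff (2 * l) j (1 / 2) *
        t ^ (2 * r - 2 * l) := by
  simp [alphaPoly, eval_finsetSum]

theorem alphaPoly_comp_neg_X (r j : ℕ) : (alphaPoly r j).comp (-X) = alphaPoly r j := by
  have h4 : ((4 : ℂ[X])).comp (-X) = 4 := by
    have : (4 : ℂ[X]) = C 4 := rfl
    rw [this, C_comp]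
  rw [alphaPoly, mul_comp, h4]
  congr 1
  rw [← coe_compRingHom_apply, map_sum]
  refine Finset.sum_congr rfl fun l _ => ?_
  rw [coe_compRingHom_apply]
  have : 2 * r - 2 * l = 2 * (r - l) := by omega
  rw [mul_comp, C_comp, X_pow_comp, this, pow_mul, pow_mul, neg_sq]

/-- The polynomial `4 (X - t) (X (2t - X))^n`. -/
noncomputable def gammaPoly (n : ℕ) (t : ℂ) : ℂ[X] :=
  C 4 * (X - C t) * (X * (C (2 * t) - X)) ^ n

/-- Summing over j first gives, by the Newton expansion, odd powers (X-t)^{2l-1}. The binomial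
theorem then sums these to 4(X-t)(t² - (X-t)²)^n, and t² - (X-t)² = X(2t-X). -/
theorem sum_alphaPoly_smul_barnesPoly (n : ℕ) (s : ℂ) :
    ∑ j ∈ Finset.Icc 1 (2 * (n + 1)), (alphaPoly (n + 1) j).eval (s - 1 / 2) • barnesPoly j s
      = gammaPoly n (s - 1 / 2) := by
  refine Polynomial.funext fun x => ?_
  obtain ⟨y, rfl⟩ : ∃ y, x = y + s := ⟨x - s, by ring⟩
  set t := s - 1 / 2 with ht
  rw [eval_finsetSum]
  simp only [eval_smul, eval_barnesPoly_add, eval_alphaPoly, smul_eq_mul]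
  have hswap : ∑ j ∈ Finset.Icc 1 (2 * (n + 1)), (4 * ∑ l ∈ Finset.Icc ((j + 1) / 2) (n + 1),
      ((n + 1 - 1).choose (l - 1) : ℂ) * (-1) ^ (l - 1) * cCoeff (2 * l) j (1 / 2) *
        t ^ (2 * (n + 1) - 2 * l)) *
        (((j - 1).factorial : ℂ)⁻¹ * (ascPochhammer ℂ (j - 1)).eval (y + 1))
      = 4 * ∑ l ∈ Finset.Icc 1 (n + 1), (n.choose (l - 1) : ℂ) * (-1) ^ (l - 1) *
        t ^ (2 * (n + 1) - 2 * l) * (y + 1 / 2) ^ (2 * l - 1) := by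
    simp only [Finset.mul_sum, Finset.sum_mul]
    -- The condition ⌊(j+1)/2⌋ ≤ l is j ≤ 2l, exactly the range of the Newton expansion of degree
    -- 2l-1.
    rw [Finset.sum_comm' (t' := Finset.Icc 1 (n + 1)) (s' := fun l => Finset.Icc 1 (2 * l))
      (by intro a b; simp only [Finset.mem_Icc]; omega)]
    refine Finset.sum_congr rfl fun l hl => ?_
    have hl := (Finset.mem_Icc.1 hl).1
    rw [← sum_cCoeff_mul_ascPochhammer (p := 2 * l) (by omega) (1 / 2) y, Finset.mul_sum,
      Finset.mul_sum]
    refine Finset.sum_congr rfl fun j _ => ?_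
    simp only [Nat.add_sub_cancel]
    ring
  rw [hswap]
  have e1 : y + s - t = y + 1 / 2 := by rw [ht]; ring
  have e2 : (y + s) * (2 * t - (y + s)) = -(y + 1 / 2) ^ 2 + t ^ 2 := by rw [ht]; ring
  simp only [gammaPoly, eval_mul, eval_C, eval_pow, eval_sub, eval_X, e1, e2]
  rw [add_pow, Finset.mul_sum, Finset.mul_sum, sum_Icc_one_eq_sum_range]
  refine Finset.sum_congr rfl fun l hl => ?_
  have hl : l ≤ n := Nat.lt_succ_iff.1 (Finset.mem_range.1 hl)
  obtain ⟨m, rfl⟩ := Nat.exists_eq_add_of_le hl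
  have a1 : 2 * (l + m + 1) - 2 * (l + 1) = 2 * m := by omega
  have a2 : 2 * (l + 1) - 1 = 2 * l + 1 := by omega
  rw [a1, a2, Nat.add_sub_cancel, Nat.add_sub_cancel_left, neg_pow ((y + 1 / 2) ^ 2), ← pow_mul,
    ← pow_mul]
  ring

end AlphaPoly

/-! ### The elementary terms and the Wallis integral -/

section MainTerm
open Polynomial

/-- The functional `p ↦ ∫_0^t p`. -/
noncomputable def integralFunctional (t : ℂ) : ℂ[X] →ₗ[ℂ] ℂ :=
  coeffSum fun k => t ^ (k + 1) / (k + 1)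

theorem integralFunctional_derivative (t : ℂ) (q : ℂ[X]) :
    integralFunctional t (derivative q) = q.eval t - q.eval 0 := by
  have hd : (derivative q).natDegree < q.natDegree + 1 :=
    (natDegree_derivative_le q).trans_lt (by omega)
  rw [integralFunctional, coeffSum_eq_sum_range _ hd, eval_eq_sum_range' (n := q.natDegree + 2)
    (by omega), Finset.sum_range_succ' _ (q.natDegree + 1), ← coeff_zero_eq_eval_zero]
  rw [pow_zero, mul_one, add_sub_cancel_right]
  refine Finset.sum_congr rfl fun k _ => ?_
  have : (k : ℂ) + 1 ≠ 0 := Nat.cast_add_one_ne_zero k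
  rw [coeff_derivative]
  field_simp

/-- The functional on the left is p ↦ ∫_0^t x^{-1} ∫_0^x p; for p = (Xq)' the inner integral is
xq(x). -/
theorem coeffSum_div_sq_derivative (t : ℂ) (q : ℂ[X]) :
    coeffSum (fun k => t ^ (k + 1) / ((k : ℂ) + 1) ^ 2) (derivative (X * q))
      = integralFunctional t q := by
  have hd : (derivative (X * q)).natDegree < q.natDegree + 1 := by
    refine (natDegree_derivative_le _).trans_lt ?_
    have := natDegree_mul_le (p := (X : ℂ[X])) (q := q)
    rw [natDegree_X] at this
    omega
  rw [integralFunctional, coeffSum_eq_sum_range _ hd, coeffSum_eq_sum_range _ (Nat.lt_succ_self _)]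
  refine Finset.sum_congr rfl fun k _ => ?_
  have : (k : ℂ) + 1 ≠ 0 := Nat.cast_add_one_ne_zero k
  rw [coeff_derivative, coeff_X_mul]
  field_simp

/-- With u = X(2t-X), the polynomial (X-t)u^{n+1} vanishes at 0 and t. Integrating its derivative
gives the Wallis recursion (2n+3)∫u^{n+1} = (2n+2)t²∫u^n. -/
theorem integralFunctional_pow (t : ℂ) (n : ℕ) :
    integralFunctional t ((X * (C (2 * t) - X)) ^ n)
      = t ^ (2 * n + 1) * ((2 * n).doubleFactorial / (2 * n + 1).doubleFactorial : ℂ) := by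
  induction n with
  | zero =>
    have h := integralFunctional_derivative t X
    rw [derivative_X] at h
    simpa using h
  | succ n ih =>
    have h := integralFunctional_derivative t ((X - C t) * (X * (C (2 * t) - X)) ^ (n + 1))
    have hd : derivative ((X - C t) * (X * (C (2 * t) - X)) ^ (n + 1))
        = (2 * (n + 1 : ℂ) + 1) • (X * (C (2 * t) - X)) ^ (n + 1)
          - (2 * (n + 1 : ℂ) * t ^ 2) • (X * (C (2 * t) - X)) ^ n := by
      refine Polynomial.funext fun x => ?_
      simp only [derivative_mul, derivative_sub, derivative_X, derivative_C, derivative_pow,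
        eval_add, eval_mul, eval_sub, eval_pow, eval_X, eval_C, eval_smul, smul_eq_mul, eval_one,
        eval_zero]
      push_cast
      ring
    rw [hd, map_sub, map_smul, map_smul, ih] at h
    simp only [eval_mul, eval_sub, eval_pow, eval_X, eval_C, smul_eq_mul, sub_self, zero_mul,
      ne_eq, Nat.add_eq_zero_iff, one_ne_zero, and_false, not_false_eq_true, zero_pow,
      mul_zero] at h
    have h3 : (2 * ((n : ℂ) + 1) + 1) ≠ 0 := by
      have : ((2 * n + 3 : ℕ) : ℂ) ≠ 0 := by exact_mod_cast (by omega : 2 * n + 3 ≠ 0)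
      intro h'; apply this; push_cast; linear_combination h'
    have h4 : ((2 * n + 1).doubleFactorial : ℂ) ≠ 0 := by
      exact_mod_cast (Nat.doubleFactorial_pos _).ne'
    have d1 : (2 * (n + 1)).doubleFactorial = (2 * n + 2) * (2 * n).doubleFactorial := by
      rw [Nat.mul_add, Nat.mul_one, Nat.doubleFactorial_add_two]
    have d2 : (2 * (n + 1) + 1).doubleFactorial = (2 * n + 3) * (2 * n + 1).doubleFactorial := by
      have : 2 * (n + 1) + 1 = 2 * n + 1 + 2 := by ring
      rw [this, Nat.doubleFactorial_add_two]
    rw [d1, d2]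
    apply mul_left_cancel₀ h3
    have h5 : (2 * (n : ℂ) + 3) ≠ 0 := by
      intro h'; apply h3; linear_combination h'
    rw [sub_eq_zero.1 h]
    push_cast
    field_simp
    ring

/-- Since 4(X-t)u^n = -(2/(n+1))(u^{n+1})' for u = X(2t-X), the log term needs only u(t) = t². The
double factorials enter through ∫u^{n+1}/x = ∫u^n(2t-x), where 2t-x = t + (t-x) and u^n(t-x) is
again exact. -/
theorem coeffSum_main_gammaPoly (n : ℕ) (t : ℂ) :
    coeffSum (fun k => t ^ (k + 1) * (Complex.log t / (k + 1) - 1 / ((k : ℂ) + 1) ^ 2))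
      (gammaPoly n t)
      = t ^ (2 * (n + 1)) * (-(2 / (n + 1)) * Complex.log t + 1 / ((n : ℂ) + 1) ^ 2 +
        ((2 * (n + 1)).doubleFactorial : ℂ) /
          (((n : ℂ) + 1) ^ 2 * (2 * (n + 1) - 1).doubleFactorial)) := by
  have hn : (n : ℂ) + 1 ≠ 0 := Nat.cast_add_one_ne_zero n
  have hq : gammaPoly n t = (-(2 / ((n : ℂ) + 1))) •
      derivative ((X * (C (2 * t) - X)) ^ (n + 1)) := by
    refine Polynomial.funext fun x => ?_
    simp only [gammaPoly, derivative_mul, derivative_sub, derivative_X, derivative_C,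
      derivative_pow, eval_add, eval_mul, eval_sub, eval_pow, eval_X, eval_C, eval_smul,
      smul_eq_mul, eval_one, eval_zero]
    push_cast
    field_simp
    ring
  have hsplit : ∀ k : ℕ, t ^ (k + 1) * (Complex.log t / (k + 1) - 1 / ((k : ℂ) + 1) ^ 2)
      = Complex.log t * (t ^ (k + 1) / (k + 1)) + (-1) * (t ^ (k + 1) / ((k : ℂ) + 1) ^ 2) := by
    intro k
    ring
  simp only [hsplit]
  rw [coeffSum_add, coeffSum_const_mul, coeffSum_const_mul, hq, map_smul, map_smul]
  have h1 := integralFunctional_derivative t ((X * (C (2 * t) - X)) ^ (n + 1))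
  rw [integralFunctional] at h1
  rw [h1]
  have hX : (X * (C (2 * t) - X) : ℂ[X]) ^ (n + 1)
      = X * ((X * (C (2 * t) - X)) ^ n * (C (2 * t) - X)) := by ring
  have h2 : integralFunctional t ((X * (C (2 * t) - X)) ^ n * (C (2 * t) - X))
      = t ^ (2 * (n + 1)) * (((2 * n).doubleFactorial / (2 * n + 1).doubleFactorial : ℂ) +
        1 / (2 * ((n : ℂ) + 1))) := by
    have e : (X * (C (2 * t) - X) : ℂ[X]) ^ n * (C (2 * t) - X)
        = t • (X * (C (2 * t) - X)) ^ n + (1 / (2 * ((n : ℂ) + 1))) •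
          derivative ((X * (C (2 * t) - X)) ^ (n + 1)) := by
      refine Polynomial.funext fun x => ?_
      simp only [derivative_mul, derivative_sub, derivative_X, derivative_C,
        derivative_pow, eval_add, eval_mul, eval_sub, eval_pow, eval_X, eval_C, eval_smul,
        smul_eq_mul, eval_one, eval_zero]
      push_cast
      field_simp
      ring
    rw [e, map_add, map_smul, map_smul, integralFunctional_pow, integralFunctional_derivative]
    simp only [eval_mul, eval_sub, eval_pow, eval_X, eval_C, smul_eq_mul, zero_mul,
      ne_eq, Nat.add_eq_zero_iff, one_ne_zero, and_false, not_false_eq_true, zero_pow]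
    ring
  have h3 : coeffSum (fun k => t ^ (k + 1) / ((k : ℂ) + 1) ^ 2)
      (derivative ((X * (C (2 * t) - X)) ^ (n + 1)))
      = t ^ (2 * (n + 1)) * (((2 * n).doubleFactorial / (2 * n + 1).doubleFactorial : ℂ) +
        1 / (2 * ((n : ℂ) + 1))) := by
    rw [hX, coeffSum_div_sq_derivative, h2]
  rw [h3]
  simp only [eval_mul, eval_sub, eval_pow, eval_X, eval_C, smul_eq_mul, zero_mul,
    ne_eq, Nat.add_eq_zero_iff, one_ne_zero, and_false, not_false_eq_true, zero_pow]
  have d1 : (2 * (n + 1)).doubleFactorial = (2 * n + 2) * (2 * n).doubleFactorial := by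
    rw [Nat.mul_add, Nat.mul_one, Nat.doubleFactorial_add_two]
  have d2 : 2 * (n + 1) - 1 = 2 * n + 1 := by omega
  have h4 : ((2 * n + 1).doubleFactorial : ℂ) ≠ 0 := by
    exact_mod_cast (Nat.doubleFactorial_pos _).ne'
  rw [d1, d2]
  push_cast
  field_simp
  ring

end MainTerm

/-! ### The product formula -/

section ProductFormula
open Polynomial MeasureTheory

theorem coeffSum_hermiteInt {t : ℂ} (ht : 0 < t.re) (p : ℂ[X]) :
    coeffSum (fun k => hermiteInt (fun z => z ^ k * Complex.log z) t) p
      = hermiteInt (fun z => p.eval z * Complex.log z) t := by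
  rw [coeffSum_eq_sum_range _ (Nat.lt_succ_self _)]
  simp only [hermiteInt]
  simp only [← integral_const_mul]
  rw [← integral_finsetSum _ fun k _ => (integrableOn_hermite_integrand
    (differentiableOn_pow_mul_log k).continuousOn (expBounded_pow_mul_log k) ht).const_mul _]
  refine integral_congr_ae (.of_forall fun y => ?_)
  simp only [eval_eq_sum_range, Finset.sum_mul, ← Finset.sum_sub_distrib]
  exact Finset.sum_congr rfl fun k _ => by ring

/-- At t ± ix the polynomial takes the values ±4ix(x²+t²)^n. The opposite signs turn the difference
in the Hermite integral into a sum of logarithms, and the factor i·4i = -4 is -2 times the 2 in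
`momentContDeriv`. -/
theorem coeffSum_hurwitzContDeriv_gammaPoly {t : ℂ} (ht : 0 < t.re) (n : ℕ) :
    coeffSum (hurwitzContDeriv t) (gammaPoly n t) =
      -2 * momentContDeriv t n + ((2 * (n + 1)).doubleFactorial : ℂ) /
          (((n : ℂ) + 1) ^ 2 * (2 * (n + 1) - 1).doubleFactorial) * t ^ (2 * (n + 1)) := by
  have hI : Complex.I * hermiteInt (fun z => (gammaPoly n t).eval z * Complex.log z) t
      = -4 * ∫ x in Set.Ioi (0 : ℝ), (Complex.log (t + x * Complex.I) +
      Complex.log (t - x * Complex.I)) * (((x : ℂ) ^ 2 + t ^ 2) ^ n * (x * fermiWeight x : ℂ)) := by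
    rw [hermiteInt, ← integral_const_mul, ← integral_const_mul]
    refine integral_congr_ae (.of_forall fun x => ?_)
    have e1 : (t + x * Complex.I) * (2 * t - (t + x * Complex.I)) = (x : ℂ) ^ 2 + t ^ 2 := by
      linear_combination (-(x : ℂ) ^ 2) * Complex.I_sq
    have e2 : (t - x * Complex.I) * (2 * t - (t - x * Complex.I)) = (x : ℂ) ^ 2 + t ^ 2 := by
      linear_combination (-(x : ℂ) ^ 2) * Complex.I_sq
    simp only [gammaPoly, eval_mul, eval_C, eval_pow, eval_sub, eval_X, e1, e2]
    linear_combination (4 * x * fermiWeight x * ((x : ℂ) ^ 2 + t ^ 2) ^ n *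
      (Complex.log (t + x * Complex.I) + Complex.log (t - x * Complex.I))) * Complex.I_sq
  have h : coeffSum (hurwitzContDeriv t) (gammaPoly n t) =
      coeffSum (fun k => t ^ (k + 1) * (Complex.log t / (k + 1) - 1 / ((k : ℂ) + 1) ^ 2))
        (gammaPoly n t) +
      Complex.I * coeffSum (fun k => hermiteInt (fun z => z ^ k * Complex.log z) t)
        (gammaPoly n t) := by
    rw [← coeffSum_const_mul, ← coeffSum_add]
    rfl
  have hn : (n : ℂ) + 1 ≠ 0 := Nat.cast_add_one_ne_zero n
  rw [h, coeffSum_hermiteInt ht, hI, coeffSum_main_gammaPoly, momentContDeriv]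
  generalize (∫ x in Set.Ioi (0 : ℝ), (Complex.log (t + x * Complex.I) +
    Complex.log (t - x * Complex.I)) * (((x : ℂ) ^ 2 + t ^ 2) ^ n * (x * fermiWeight x : ℂ))) = A
  field_simp
  ring

theorem gammaFactor_eq {s : ℂ} (hs : 1 / 2 < s.re) {r : ℕ} (hr : 1 ≤ r) :
    gammaFactor r s = expFactor r s * ∏ j ∈ Finset.Icc 1 (2 * r),
      Complex.exp ((alphaPoly r j).eval (s - 1 / 2) * logBarnesGamma j s) := by
  obtain ⟨n, rfl⟩ : ∃ n, r = n + 1 := ⟨r - 1, by omega⟩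
  have ht : 0 < (s - 1 / 2).re := by
    simp
    linarith
  have hsn : ∀ k : ℕ, s ≠ -(k : ℂ) := by
    rintro k rfl
    have : (0 : ℝ) ≤ k := Nat.cast_nonneg k
    simp at hs
    linarith
  have hlog : ∀ j ∈ Finset.Icc 1 (2 * (n + 1)), (alphaPoly (n + 1) j).eval (s - 1 / 2) *
      logBarnesGamma j s = coeffSum (hurwitzContDeriv (s - 1 / 2))
        ((alphaPoly (n + 1) j).eval (s - 1 / 2) • barnesPoly j s) := by
    intro j hj
    rw [logBarnesGamma_eq (M := 0) (Finset.mem_Icc.1 hj).1 (by simpa using hs) hsn, map_smul,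
      smul_eq_mul]
    simp [barnesTail]
  rw [gammaFactor, ← Complex.exp_sum, ← Complex.exp_sum, expFactor, ← Complex.exp_add]
  congr 1
  rw [Finset.sum_congr rfl hlog, ← map_sum, sum_alphaPoly_smul_barnesPoly,
    coeffSum_hurwitzContDeriv_gammaPoly ht, ← sum_choose_mul_momentDeriv ht, Finset.mul_sum]
  push_cast
  rw [add_left_comm, neg_mul, neg_add_cancel, add_zero]
  refine Finset.sum_congr rfl fun l _ => ?_
  ring

end ProductFormula

/-! ### Continuation of φ_r beyond the half plane -/

section BarnesGammaContinuation

theorem isOpen_tail_domain (M : ℕ) : IsOpen {z : ℂ | 1 / 2 - (M : ℝ) < z.re} :=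
  isOpen_lt continuous_const Complex.continuous_re

theorem ne_neg_natCast_of_tail {M : ℕ} {s : ℂ} (hM : 1 / 2 - (M : ℝ) < s.re)
    (hs : ∀ N ∈ Finset.range M, s ≠ -(N : ℂ)) (k : ℕ) : s ≠ -(k : ℂ) := by
  intro h
  refine hs k (Finset.mem_range.2 ?_) h
  rw [h] at hM
  simp at hM
  have : (k : ℝ) < M := by linarith
  exact_mod_cast this

theorem eventually_nhdsNE_ne (x c : ℂ) : ∀ᶠ s in 𝓝[≠] x, s ≠ c := by
  by_cases h : x = c
  · subst h
    exact self_mem_nhdsWithin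
  · exact nhdsWithin_le_nhds (isOpen_ne.mem_nhds h)

theorem eventually_nhdsNE_ne_neg_natCast (x : ℂ) {M : ℕ} (hM : 1 / 2 - (M : ℝ) < x.re) :
    ∀ᶠ s in 𝓝[≠] x, 1 / 2 - (M : ℝ) < s.re ∧ ∀ k : ℕ, s ≠ -(k : ℂ) := by
  filter_upwards [nhdsWithin_le_nhds ((isOpen_tail_domain M).mem_nhds hM),
    (Filter.eventually_all_finset (Finset.range M)).2 fun N _ => eventually_nhdsNE_ne x (-(N : ℂ))]
    with s h1 h2
  exact ⟨h1, ne_neg_natCast_of_tail h1 h2⟩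

theorem eventually_ne_neg_natCast {x : ℂ} (hx : ∀ k : ℕ, x ≠ -(k : ℂ)) {M : ℕ}
    (hM : 1 / 2 - (M : ℝ) < x.re) :
    ∀ᶠ s in 𝓝 x, 1 / 2 - (M : ℝ) < s.re ∧ ∀ k : ℕ, s ≠ -(k : ℂ) := by
  filter_upwards [(isOpen_tail_domain M).mem_nhds hM,
    (Filter.eventually_all_finset (Finset.range M)).2 fun N _ => isOpen_ne.mem_nhds (hx N)]
    with s h1 h2
  exact ⟨h1, ne_neg_natCast_of_tail h1 h2⟩

theorem eval_alphaPoly_one_one (t : ℂ) : (alphaPoly 1 1).eval t = ((-2 : ℤ) : ℂ) := by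
  rw [eval_alphaPoly]
  simp [cCoeff]
  norm_num

theorem eval_alphaPoly_one_two (t : ℂ) : (alphaPoly 1 2).eval t = ((4 : ℤ) : ℂ) := by
  rw [eval_alphaPoly]
  simp [cCoeff, Finset.sum_range_succ]

theorem prod_Icc_one_two (f : ℕ → ℂ) : ∏ j ∈ Finset.Icc 1 (2 * 1), f j = f 1 * f 2 := by
  have : Finset.Icc 1 (2 * 1) = {1, 2} := rfl
  rw [this, Finset.prod_pair (by norm_num)]

theorem barnesGamma_cpow_intCast (j : ℕ) (s : ℂ) (m : ℤ) :
    barnesGamma j s ^ (m : ℂ) = Complex.exp (m * logBarnesGamma j s) := by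
  rw [Complex.cpow_intCast, barnesGamma, Complex.exp_int_mul]

/-- The formula for the continuation of `φ_1`. -/
noncomputable def gammaFactorOne (s : ℂ) : ℂ :=
  expFactor 1 s *
    ∏ j ∈ Finset.Icc 1 (2 * 1), barnesGamma j s ^ ((alphaPoly 1 j).eval (s - 1 / 2))

theorem gammaFactorOne_eq_exp (s : ℂ) : gammaFactorOne s =
    expFactor 1 s * Complex.exp (-2 * logBarnesGamma 1 s + 4 * logBarnesGamma 2 s) := by
  rw [gammaFactorOne, prod_Icc_one_two, eval_alphaPoly_one_one, eval_alphaPoly_one_two,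
    barnesGamma_cpow_intCast, barnesGamma_cpow_intCast, ← Complex.exp_add]
  push_cast
  rfl

theorem gammaFactorOne_eq_gammaFactor {s : ℂ} (hs : 1 / 2 < s.re) :
    gammaFactorOne s = gammaFactor 1 s := by
  rw [gammaFactor_eq hs le_rfl, gammaFactorOne, prod_Icc_one_two, prod_Icc_one_two,
    eval_alphaPoly_one_one, eval_alphaPoly_one_two, barnesGamma_cpow_intCast,
    barnesGamma_cpow_intCast]

/-- The zero-free factor of `φ_1` on `Re s > 1/2 - M`. -/
noncomputable def gammaFactorOneTail (M : ℕ) (s : ℂ) : ℂ :=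
  expFactor 1 s * Complex.exp (-2 * barnesTail 1 M s + 4 * barnesTail 2 M s)

theorem differentiable_expFactor (r : ℕ) : Differentiable ℂ (expFactor r) := by
  unfold expFactor
  fun_prop

theorem analyticAt_gammaFactorOneTail {M : ℕ} {s : ℂ} (hM : 1 / 2 - (M : ℝ) < s.re) :
    AnalyticAt ℂ (gammaFactorOneTail M) s := by
  have h1 := (differentiableOn_barnesTail (n := 1) le_rfl M).analyticAt
    ((isOpen_tail_domain M).mem_nhds hM)
  have h2 := (differentiableOn_barnesTail (n := 2) one_le_two M).analyticAt
    ((isOpen_tail_domain M).mem_nhds hM)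
  exact ((differentiable_expFactor 1).analyticAt s).mul
    ((analyticAt_const.mul h1).add (analyticAt_const.mul h2)).cexp

theorem gammaFactorOneTail_ne_zero (M : ℕ) (s : ℂ) : gammaFactorOneTail M s ≠ 0 :=
  mul_ne_zero (Complex.exp_ne_zero _) (Complex.exp_ne_zero _)

/-- The layer N has multiplicity 1 in Γ_1 and N+1 in Γ_2, so the exponents -2 and 4 give 2 - 4(N+1).
These are integers, hence the logarithms exponentiate without a branch. -/
theorem gammaFactorOne_eq_prod {M : ℕ} {s : ℂ} (hM : 1 / 2 - (M : ℝ) < s.re)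
    (hs : ∀ k : ℕ, s ≠ -(k : ℂ)) :
    gammaFactorOne s = (∏ N ∈ Finset.range M, ((N : ℂ) + s) ^ (-(2 * (2 * (N : ℤ) + 1)))) *
      gammaFactorOneTail M s := by
  have hne : ∀ N : ℕ, (N : ℂ) + s ≠ 0 := fun N h => hs N (by linear_combination h)
  have hp : ∀ N : ℕ, ((N : ℂ) + s) ^ (-(2 * (2 * (N : ℤ) + 1)))
      = Complex.exp (((-(2 * (2 * (N : ℤ) + 1)) : ℤ) : ℂ) * Complex.log ((N : ℂ) + s)) := by
    intro N
    rw [Complex.exp_int_mul, Complex.exp_log (hne N)]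
  rw [gammaFactorOne_eq_exp, logBarnesGamma_eq le_rfl hM hs, logBarnesGamma_eq one_le_two hM hs,
    gammaFactorOneTail]
  simp only [hp]
  rw [← Complex.exp_sum, mul_left_comm, ← Complex.exp_add]
  congr 2
  have hsum : ∑ N ∈ Finset.range M,
      ((-(2 * (2 * (N : ℤ) + 1)) : ℤ) : ℂ) * Complex.log ((N : ℂ) + s)
      = 2 * ∑ N ∈ Finset.range M, ((N + 1 - 1).choose (1 - 1) : ℂ) * Complex.log ((N : ℂ) + s) -
        4 * ∑ N ∈ Finset.range M, ((N + 2 - 1).choose (2 - 1) : ℂ) * Complex.log ((N : ℂ) + s) := by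
    rw [Finset.mul_sum, Finset.mul_sum, ← Finset.sum_sub_distrib]
    refine Finset.sum_congr rfl fun N _ => ?_
    simp
    ring
  rw [hsum]
  ring

theorem analyticAt_natCast_add_zpow {N : ℕ} {s : ℂ} (h : (N : ℂ) + s ≠ 0) (m : ℤ) :
    AnalyticAt ℂ (fun s => ((N : ℂ) + s) ^ m) s :=
  AnalyticAt.fun_zpow (by fun_prop) h

theorem meromorphic_gammaFactorOne : Meromorphic gammaFactorOne := by
  intro x
  obtain ⟨M, hM⟩ := exists_tail_index x
  have h : MeromorphicAt (fun s => (∏ N ∈ Finset.range M,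
      ((N : ℂ) + s) ^ (-(2 * (2 * (N : ℤ) + 1)))) * gammaFactorOneTail M s) x := by
    refine (MeromorphicAt.fun_prod fun N _ => ?_).mul
      (analyticAt_gammaFactorOneTail hM).meromorphicAt
    have : AnalyticAt ℂ (fun s : ℂ => (N : ℂ) + s) x := by fun_prop
    exact this.meromorphicAt.zpow _
  refine h.congr ?_
  filter_upwards [eventually_nhdsNE_ne_neg_natCast x hM] with s hs
  exact (gammaFactorOne_eq_prod hs.1 hs.2).symm

theorem analyticAt_gammaFactorOne {x : ℂ} (hx : ∀ k : ℕ, x ≠ -(k : ℂ)) :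
    AnalyticAt ℂ gammaFactorOne x := by
  obtain ⟨M, hM⟩ := exists_tail_index x
  have h : AnalyticAt ℂ (fun s => (∏ N ∈ Finset.range M,
      ((N : ℂ) + s) ^ (-(2 * (2 * (N : ℤ) + 1)))) * gammaFactorOneTail M s) x :=
    (Finset.analyticAt_fun_prod _ fun N _ => analyticAt_natCast_add_zpow
      (fun h => hx N (by linear_combination h)) _).mul (analyticAt_gammaFactorOneTail hM)
  refine h.congr ?_
  filter_upwards [eventually_ne_neg_natCast hx hM] with s hs
  exact (gammaFactorOne_eq_prod hs.1 hs.2).symm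

theorem meromorphicOrderAt_gammaFactorOne (k : ℕ) :
    meromorphicOrderAt gammaFactorOne (-(k : ℂ))
      = ((-(2 * (2 * (k : ℤ) + 1)) : ℤ) : WithTop ℤ) := by
  -- With M = k+1 layers the last factor carries the pole at -k, and all others are analytic and
  -- nonzero there.
  have hM : 1 / 2 - ((k + 1 : ℕ) : ℝ) < (-(k : ℂ)).re := by
    push_cast
    simp
    linarith
  have hne : ∀ N ∈ Finset.range k, (N : ℂ) + -(k : ℂ) ≠ 0 := by
    intro N hN h
    have h' : (N : ℂ) = k := by linear_combination h
    exact (Finset.mem_range.1 hN).ne (by exact_mod_cast h')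
  rw [meromorphicOrderAt_eq_int_iff (meromorphic_gammaFactorOne _)]
  refine ⟨fun s => (∏ N ∈ Finset.range k, ((N : ℂ) + s) ^ (-(2 * (2 * (N : ℤ) + 1)))) *
    gammaFactorOneTail (k + 1) s, ?_, ?_, ?_⟩
  · exact (Finset.analyticAt_fun_prod _ fun N hN => analyticAt_natCast_add_zpow
      (hne N hN) _).mul (analyticAt_gammaFactorOneTail hM)
  · exact mul_ne_zero (Finset.prod_ne_zero_iff.2 fun N hN => zpow_ne_zero _ (hne N hN))
      (gammaFactorOneTail_ne_zero _ _)
  · filter_upwards [eventually_nhdsNE_ne_neg_natCast _ hM] with s hs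
    rw [gammaFactorOne_eq_prod hs.1 hs.2, Finset.prod_range_succ, smul_eq_mul, sub_neg_eq_add,
      add_comm s]
    ring

/-- The branch of `log Γ_n` on `slitRegion`. -/
noncomputable def slitLogBarnesGamma (n : ℕ) (s : ℂ) : ℂ :=
  logBarnesGamma n s + Complex.log s -
    (Complex.log (-Complex.I * s) + Real.pi / 2 * Complex.I)

theorem ne_neg_natCast_of_mem_slitRegion {s : ℂ} (hs : s ∈ slitRegion) (k : ℕ) :
    s ≠ -(k : ℂ) := by
  rintro rfl
  obtain ⟨h1, h2⟩ := hs
  rcases Nat.eq_zero_or_pos k with rfl | hk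
  · simp at h2
  · have : (1 : ℝ) ≤ k := by exact_mod_cast hk
    exact h1 (by simpa using this)

/-- For Re s > 0 the sum arg(-i) + arg s lies in (-π, 0), so log(-is) + iπ/2 is the principal log s.
-/
theorem slitLogBarnesGamma_eq {n : ℕ} {s : ℂ} (hs : 0 < s.re) :
    slitLogBarnesGamma n s = logBarnesGamma n s := by
  have hs0 := ne_zero_of_re_pos hs
  have h := abs_lt.1 (Complex.abs_arg_lt_pi_div_two_iff.2 (Or.inl hs))
  have hI : -Complex.I ≠ 0 := neg_ne_zero.2 Complex.I_ne_zero
  rw [slitLogBarnesGamma, Complex.log_mul hI hs0, Complex.log_neg_I]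
  · ring
  · rw [Complex.arg_neg_I]
    constructor <;> linarith [h.1, h.2, Real.pi_pos]

theorem exp_slitLogBarnesGamma {n : ℕ} {s : ℂ} (hs : s ≠ 0) :
    Complex.exp (slitLogBarnesGamma n s) = barnesGamma n s := by
  have hI : -Complex.I * s ≠ 0 := mul_ne_zero (neg_ne_zero.2 Complex.I_ne_zero) hs
  rw [slitLogBarnesGamma, Complex.exp_sub, Complex.exp_add, Complex.exp_add, Complex.exp_log hs,
    Complex.exp_log hI, Complex.exp_pi_div_two_mul_I, ← barnesGamma]
  have : -Complex.I * s * Complex.I = s := by linear_combination (-s) * Complex.I_sq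
  rw [this, mul_div_cancel_right₀ _ hs]

/-- The layer N = 0 has multiplicity 1, so adding log s removes its cut, and log(-is) is cut only
along the negative imaginary axis. The layers N ≥ 1 have their cuts inside (-∞,-1]. -/
theorem differentiableOn_slitLogBarnesGamma {n : ℕ} (hn : 1 ≤ n) :
    DifferentiableOn ℂ (slitLogBarnesGamma n) slitRegion := by
  intro x hx
  obtain ⟨M, hM⟩ := exists_tail_index x
  -- Taking M+1 layers guarantees that the layer N = 0 is present to cancel log s.
  have hM' : 1 / 2 - ((M + 1 : ℕ) : ℝ) < x.re := by
    push_cast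
    linarith
  have hmem : ∀ N : ℕ, ((N + 1 : ℕ) : ℂ) + x ∈ Complex.slitPlane := by
    intro N
    rw [Complex.mem_slitPlane_iff_not_le_zero]
    intro hle
    rw [Complex.le_def] at hle
    refine hx.1 ⟨by simpa using hle.2, ?_⟩
    have h1 : (N : ℝ) + 1 + x.re ≤ 0 := by simpa using hle.1
    have h2 : (0 : ℝ) ≤ N := Nat.cast_nonneg N
    linarith
  have hmem0 : -Complex.I * x ∈ Complex.slitPlane := by
    rw [Complex.mem_slitPlane_iff_not_le_zero]
    intro hle
    rw [Complex.le_def] at hle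
    exact hx.2 ⟨by simpa using hle.2, by simpa using hle.1⟩
  have h : DifferentiableAt ℂ (fun s => -∑ N ∈ Finset.range M,
      ((N + 1 + n - 1).choose (n - 1) : ℂ) * Complex.log (((N + 1 : ℕ) : ℂ) + s) +
        barnesTail n (M + 1) s - (Complex.log (-Complex.I * s) + Real.pi / 2 * Complex.I)) x := by
    refine ((DifferentiableAt.fun_sum fun N _ => ?_).fun_neg.fun_add ?_).fun_sub ?_
    · exact (DifferentiableAt.clog (by fun_prop) (hmem N)).const_mul _
    · exact (differentiableOn_barnesTail hn (M + 1)).differentiableAt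
        ((isOpen_tail_domain (M + 1)).mem_nhds hM')
    · exact (DifferentiableAt.clog (by fun_prop) hmem0).add_const _
  refine (h.congr_of_eventuallyEq ?_).differentiableWithinAt
  filter_upwards [eventually_ne_neg_natCast (ne_neg_natCast_of_mem_slitRegion hx) hM'] with s hs
  rw [slitLogBarnesGamma, logBarnesGamma_eq hn hs.1 hs.2, Finset.sum_range_succ']
  simp
  ring

end BarnesGammaContinuation

theorem theorem3p7 (r : ℕ) (hr : 1 ≤ r) :
    -- the continuations behind `φ_r` and `Γ_1, …, Γ_{2r}` exist
    (∀ ℓ ∈ Finset.range r, ∀ s : ℂ, 1 / 2 < s.re →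
      ∃ d, HasContinuedDerivAt (fun w => momentIntegral (2 * ℓ + 1) w (s - 1 / 2))
        ((ℓ : ℝ) + 1) 0 d) ∧
    (∀ j ∈ Finset.Icc 1 (2 * r), ∀ s : ℂ, (∀ k : ℕ, s ≠ -(k : ℂ)) →
      ∃ d, HasContinuedDerivAt (fun w => barnesZetaSeries j w s) j 0 d) ∧
    -- the polynomials `α_{r,j}` are even
    (∀ j ∈ Finset.Icc 1 (2 * r), (alphaPoly r j).comp (-Polynomial.X) = alphaPoly r j) ∧
    -- the product formula
    (∀ s : ℂ, 1 / 2 < s.re →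
      gammaFactor r s = expFactor r s *
        ∏ j ∈ Finset.Icc 1 (2 * r),
          Complex.exp ((alphaPoly r j).eval (s - 1 / 2) * logBarnesGamma j s)) ∧
    -- (i) meromorphic continuation for `r = 1`
    (r = 1 → ∃ Φ : ℂ → ℂ, Meromorphic Φ ∧
      (∀ s : ℂ, 1 / 2 < s.re → Φ s = gammaFactor r s) ∧
      (∀ s : ℂ, (∀ k : ℕ, s ≠ -(k : ℂ)) → AnalyticAt ℂ Φ s ∧
        Φ s = expFactor r s *
          ∏ j ∈ Finset.Icc 1 (2 * r), barnesGamma j s ^ ((alphaPoly r j).eval (s - 1 / 2))) ∧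
      (∀ k : ℕ, meromorphicOrderAt Φ (-(k : ℂ)) = ((-(2 * (2 * (k : ℤ) + 1)) : ℤ) : WithTop ℤ))) ∧
    -- (ii) analytic continuation to the slit region for `r ≥ 2`
    (2 ≤ r → ∃ (Φ : ℂ → ℂ) (L : ℕ → ℂ → ℂ), DifferentiableOn ℂ Φ slitRegion ∧
      (∀ s : ℂ, 1 / 2 < s.re → Φ s = gammaFactor r s) ∧
      (∀ j ∈ Finset.Icc 1 (2 * r), DifferentiableOn ℂ (L j) slitRegion ∧
        (∀ s : ℂ, 0 < s.re → L j s = logBarnesGamma j s) ∧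
        (∀ s ∈ slitRegion, Complex.exp (L j s) = barnesGamma j s)) ∧
      (∀ s ∈ slitRegion, Φ s = expFactor r s *
        ∏ j ∈ Finset.Icc 1 (2 * r),
          Complex.exp ((alphaPoly r j).eval (s - 1 / 2) * L j s))) := by
  refine ⟨fun l _ s hs => ?_, fun j hj s hs => ?_, fun j _ => alphaPoly_comp_neg_X r j,
    fun s hs => gammaFactor_eq hs hr, ?_, fun _ => ?_⟩
  · have ht : 0 < (s - 1 / 2).re := by
      simp
      linarith
    exact ⟨_, hasContinuedDerivAt_momentIntegral ht l⟩
  · obtain ⟨M, hM⟩ := exists_tail_index s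
    exact ⟨_, hasContinuedDerivAt_barnesZetaSeries (Finset.mem_Icc.1 hj).1 hM hs⟩
  · rintro rfl
    exact ⟨gammaFactorOne, meromorphic_gammaFactorOne, fun s hs => gammaFactorOne_eq_gammaFactor hs,
      fun s hs => ⟨analyticAt_gammaFactorOne hs, rfl⟩, meromorphicOrderAt_gammaFactorOne⟩
  · refine ⟨fun s => expFactor r s * ∏ j ∈ Finset.Icc 1 (2 * r),
      Complex.exp ((alphaPoly r j).eval (s - 1 / 2) * slitLogBarnesGamma j s),
      slitLogBarnesGamma, ?_, fun s hs => ?_, fun j hj => ⟨differentiableOn_slitLogBarnesGamma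
        (Finset.mem_Icc.1 hj).1, fun s hs => slitLogBarnesGamma_eq hs, fun s hs =>
        exp_slitLogBarnesGamma (by simpa using ne_neg_natCast_of_mem_slitRegion hs 0)⟩,
      fun s _ => rfl⟩
    · refine (differentiable_expFactor r).differentiableOn.mul
        (DifferentiableOn.fun_finsetProd fun j hj => (DifferentiableOn.mul ?_
          (differentiableOn_slitLogBarnesGamma (Finset.mem_Icc.1 hj).1)).cexp)
      have h : Differentiable ℂ fun s : ℂ => s - 1 / 2 := by fun_prop
      exact ((alphaPoly r j).differentiable.comp h).differentiableOn
    · have h : ∀ j, slitLogBarnesGamma j s = logBarnesGamma j s := fun j =>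
        slitLogBarnesGamma_eq (by linarith)
      simp only [gammaFactor_eq hs hr, h]
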